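/- Call a set $\Sigma\subset\mathbb R^3$ an \emph{ovoid} if it is a compact, simply connected regular surface without boundary, of class $C^2$ (in particular this covers $C^\infty$ surfaces), which for each of its points lies entirely on one side of its tangent plane at that point. For a unit vector $n$ let $p(n)=\max_{x\in\Sigma}\langle x,n\rangle$ be the support function of $\Sigma$. The ovoid has \emph{constant width} $w$ if $p(n)+p(-n)=w$ for every unit vector $n$, that is, if any two distinct parallel tangent planes are at distance $w$. Two points $P,Q\in\Sigma$ are \emph{opposite} if the outward unit normals of $\Sigma$ at $P$ and $Q$ are opposite vectors. Let $\kappa_0(P)\ge\kappa_1(P)\ge 0$ be the principal curvatures at $P$, i.e. the maximum and the minimum of the normal curvatures at $P$ with respect to the inward normal; let $\rho_i(P)=1/\kappa_i(P)\in(0,\infty]$ be the principal radii of curvature (with $1/0=\infty$), and let $\rho_{\mathrm{mean}}(P)=\tfrac12\big(\rho_0(P)+\rho_1(P)\big)$. \textbf{Theorem.} Let $\Sigma$ be an ovoid and let $w>0$. Then $\Sigma$ is a surface of constant width $w$ if and only if $$\rho_{\mathrm{mean}}(P)+\rho_{\mathrm{mean}}(Q)=w$$ for every pair of opposite points $P,Q\in\Sigma$.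 -/

import Mathlib

open scoped Topology ENNReal

namespace Ovoid

/-- Euclidean three-space. -/
abbrev E3 : Type := EuclideanSpace ℝ (Fin 3)

/-- A regular surface of class `C²` without boundary: near each of its points, `S` is the zero set
of a `C²` function whose derivative does not vanish there. -/
def IsRegularSurface (S : Set E3) : Prop :=
  ∀ P ∈ S, ∃ F : E3 → ℝ, ContDiffAt ℝ 2 F P ∧ fderiv ℝ F P ≠ 0 ∧
    ∀ᶠ x in 𝓝 P, (x ∈ S ↔ F x = 0)

/-- `γ` is (near parameter `0`) a `C²` curve lying in `S`, with `γ 0 = P`. -/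
def IsCurveAt (S : Set E3) (P : E3) (γ : ℝ → E3) : Prop :=
  ContDiffAt ℝ 2 γ 0 ∧ γ 0 = P ∧ ∀ᶠ s in 𝓝 (0 : ℝ), γ s ∈ S

/-- The vectors tangent to `S` at `P`: velocities of curves in `S` through `P`. -/
def tangentVectors (S : Set E3) (P : E3) : Set E3 :=
  {v | ∃ γ : ℝ → E3, IsCurveAt S P γ ∧ deriv γ 0 = v}

/-- `n` is an outward unit normal of `S` at `P ∈ S`: it is orthogonal to the tangent plane at `P`,
and `S` lies entirely on the side of that plane away from which `n` points. -/
def IsOutwardNormal (S : Set E3) (P n : E3) : Prop :=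
  P ∈ S ∧ ‖n‖ = 1 ∧ (∀ v ∈ tangentVectors S P, inner ℝ v n = 0) ∧
    ∀ x ∈ S, inner ℝ (x - P) n ≤ 0

/-- An ovoid: a compact simply connected smooth surface that lies, for each of its points,
entirely on one side of its tangent plane at that point. -/
structure IsOvoid (S : Set E3) : Prop where
  isCompact : IsCompact S
  simplyConnected : SimplyConnectedSpace S
  regular : IsRegularSurface S
  oneSided : ∀ P ∈ S, ∃ n, IsOutwardNormal S P n

/-- The support function: `⟪x, n⟫ = supportFunction S n` is the supporting plane of `S` with
outward unit normal `n`. -/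
noncomputable def supportFunction (S : Set E3) (n : E3) : ℝ :=
  sSup ((fun x => inner ℝ x n) '' S)

/-- The distance between the two tangent planes orthogonal to the unit vector `n`. -/
noncomputable def width (S : Set E3) (n : E3) : ℝ :=
  supportFunction S n + supportFunction S (-n)

/-- `S` has constant width `w`. -/
def HasConstantWidth (S : Set E3) (w : ℝ) : Prop :=
  ∀ n : E3, ‖n‖ = 1 → width S n = w

/-- `P` and `Q` are opposite points: points of `S` with opposite outward normals. -/
def AreOpposite (S : Set E3) (P Q : E3) : Prop :=
  ∃ n, IsOutwardNormal S P n ∧ IsOutwardNormal S Q (-n)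

/-- The normal curvatures of `S` at `P` in all tangent directions, with respect to the inward
normal `-n` (so that those of a sphere are positive). -/
def normalCurvatures (S : Set E3) (P : E3) : Set ℝ :=
  {κ | ∃ (n : E3) (γ : ℝ → E3), IsOutwardNormal S P n ∧ IsCurveAt S P γ ∧
    ‖deriv γ 0‖ = 1 ∧ κ = inner ℝ (deriv (deriv γ) 0) (-n)}

/-- The larger principal curvature: the maximum of the normal curvatures. -/
noncomputable def κ₀ (S : Set E3) (P : E3) : ℝ := sSup (normalCurvatures S P)

/-- The smaller principal curvature: the minimum of the normal curvatures. -/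
noncomputable def κ₁ (S : Set E3) (P : E3) : ℝ := sInf (normalCurvatures S P)

/-- The principal radius of curvature `1 / κ₀`, with value `∞` where a principal curvature of the
ovoid (which is never negative) vanishes. -/
noncomputable def ρ₀ (S : Set E3) (P : E3) : ℝ≥0∞ := (ENNReal.ofReal (κ₀ S P))⁻¹

/-- The principal radius of curvature `1 / κ₁`, with the same convention. -/
noncomputable def ρ₁ (S : Set E3) (P : E3) : ℝ≥0∞ := (ENNReal.ofReal (κ₁ S P))⁻¹

/-- The mean radius of curvature. -/
noncomputable def ρmean (S : Set E3) (P : E3) : ℝ≥0∞ := (ρ₀ S P + ρ₁ S P) / 2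

end Ovoid

namespace Ovoid

/-! ### Calculus preliminaries -/

/-! Either side of the equivalence forces every normal curvature to be positive. If the width is
constantly `w`, then `S` has diameter at most `w` and opposite points satisfy `P - Q = w • n`; so
`S` lies in the ball of radius `w` about `Q` and touches its boundary at `P`, whence all normal
curvatures at `P` are at least `1 / w`. Conversely, finite mean radii exclude a vanishing `κ₁`.

Positive curvature makes the Gauss map invertible with a C¹ inverse, which extends to a map `X` on
the nonzero vectors, constant along rays (`exists_inverseGaussMap`). Its derivative at a unit vector
`n` is symmetric, kills `n`, and has the principal radii as eigenvalues on the tangent plane, so its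
trace is `2 ρmean`. Let `Z y = X y - X (-y) - w y / ‖y‖`. The trace of its derivative at `n` is `2
(ρmean P + ρmean Q - w)`, and `⟪Z n, n⟫` is the width in direction `n` minus `w`.

Constant width gives `Z = 0`, hence zero trace. For the converse, the classical argument is that `h
= p(n) + p(-n) - w` solves `Δh + 2h = 0` on the sphere, so it is a spherical harmonic of degree one,
hence odd; being even, it vanishes. `inner_eq_inner_neg_of_trace_eq_zero` supplies the oddness by
averaging over rotations about an axis, which reduces the equation to an ODE in the polar angle. -/

theorem exists_contDiffAt_localInverse {E : Type*} [NormedAddCommGroup E] [NormedSpace ℝ E]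
    [FiniteDimensional ℝ E] {f : E → E} {P : E} {k : WithTop ℕ∞}
    (hf : ContDiffAt ℝ k f P) (hk : k ≠ 0) (hinj : Function.Injective (fderiv ℝ f P)) :
    ∃ G : E → E, ContDiffAt ℝ k G (f P) ∧ G (f P) = P ∧ (∀ᶠ x in 𝓝 P, G (f x) = x) ∧
      ∀ᶠ y in 𝓝 (f P), f (G y) = y := by
  have : CompleteSpace E := FiniteDimensional.complete ℝ E
  let e : E ≃L[ℝ] E :=
    (LinearEquiv.ofInjectiveEndo (fderiv ℝ f P : E →ₗ[ℝ] E) hinj).toContinuousLinearEquiv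
  have he : (e : E →L[ℝ] E) = fderiv ℝ f P := by ext v; rfl
  have hd : HasFDerivAt f (e : E →L[ℝ] E) P := by
    rw [he]; exact (hf.differentiableAt hk).hasFDerivAt
  have hs := hf.hasStrictFDerivAt' hd hk
  exact ⟨hf.localInverse hd hk, hf.to_localInverse hd hk, hf.localInverse_apply_image hd hk,
    hs.eventually_left_inverse, hs.eventually_right_inverse⟩

/-- A positive second derivative at a critical point would make it a local minimum as well, so `f`
would be locally constant. -/
theorem deriv_deriv_nonpos_of_isLocalMax {f : ℝ → ℝ} {a : ℝ} (hf : ContinuousAt f a)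
    (h : IsLocalMax f a) : deriv (deriv f) a ≤ 0 := by
  by_contra! hpos
  have hmin := isLocalMin_of_deriv_deriv_pos hpos h.deriv_eq_zero hf
  have hc : f =ᶠ[𝓝 a] fun _ => f a := by
    filter_upwards [h, hmin] with x h1 h2 using le_antisymm h1 h2
  have h2 : deriv f =ᶠ[𝓝 a] fun _ => 0 := by
    filter_upwards [hc.eventuallyEq_nhds] with x hx
    rw [hx.deriv_eq, deriv_const]
  rw [h2.deriv_eq, deriv_const] at hpos
  exact lt_irrefl _ hpos

/-! ### Second derivatives of scalar functions along curves -/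

section Curves

variable {E : Type*} [NormedAddCommGroup E] [InnerProductSpace ℝ E] {γ : ℝ → E} {a : ℝ}

theorem eventually_hasDerivAt_of_contDiffAt_two (hγ : ContDiffAt ℝ 2 γ a) :
    ∀ᶠ s in 𝓝 a, HasDerivAt γ (deriv γ s) s := by
  filter_upwards [hγ.eventually (by simp)] with s hs
  exact (hs.differentiableAt (by simp)).hasDerivAt

theorem hasDerivAt_deriv_of_contDiffAt_two (hγ : ContDiffAt ℝ 2 γ a) :
    HasDerivAt (deriv γ) (deriv (deriv γ) a) a := by
  have h : ContDiffAt ℝ 1 (fun s => fderiv ℝ γ s 1) a :=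
    (hγ.fderiv_right (m := 1) (by norm_num)).clm_apply contDiffAt_const
  exact (h.differentiableAt (by simp)).hasDerivAt

theorem deriv_inner_right_eventuallyEq (hγ : ContDiffAt ℝ 2 γ a) (c m : E) :
    deriv (fun s => inner ℝ (γ s - c) m) =ᶠ[𝓝 a] fun s => inner ℝ (deriv γ s) m := by
  filter_upwards [eventually_hasDerivAt_of_contDiffAt_two hγ] with s hs
  simpa using ((hs.sub_const c).inner ℝ (hasDerivAt_const s m)).deriv

theorem deriv_deriv_inner_right (hγ : ContDiffAt ℝ 2 γ a) (c m : E) :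
    deriv (deriv (fun s => inner ℝ (γ s - c) m)) a = inner ℝ (deriv (deriv γ) a) m := by
  rw [(deriv_inner_right_eventuallyEq hγ c m).deriv_eq]
  simpa using ((hasDerivAt_deriv_of_contDiffAt_two hγ).inner ℝ (hasDerivAt_const a m)).deriv

theorem deriv_deriv_normSq_sub (hγ : ContDiffAt ℝ 2 γ a) (c : E) :
    deriv (deriv (fun s => inner ℝ (γ s - c) (γ s - c))) a =
      2 * (inner ℝ (deriv (deriv γ) a) (γ a - c) + inner ℝ (deriv γ a) (deriv γ a)) := by
  have h : deriv (fun s => inner ℝ (γ s - c) (γ s - c)) =ᶠ[𝓝 a]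
      fun s => 2 * inner ℝ (deriv γ s) (γ s - c) := by
    filter_upwards [eventually_hasDerivAt_of_contDiffAt_two hγ] with s hs
    rw [((hs.sub_const c).inner ℝ (hs.sub_const c)).deriv, real_inner_comm, two_mul]
  rw [h.deriv_eq]
  have h1 := ((hasDerivAt_deriv_of_contDiffAt_two hγ).inner ℝ
    ((eventually_hasDerivAt_of_contDiffAt_two hγ).self_of_nhds.sub_const c)).const_mul 2
  rw [h1.deriv, add_comm]

end Curves

/-- A scalar function that vanishes to the right of `a` has vanishing second derivative there. -/
theorem deriv_deriv_eq_zero_of_eventually_right {f : ℝ → ℝ} {a : ℝ} (hf : ContDiffAt ℝ 2 f a)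
    (h : ∀ᶠ s in 𝓝[>] a, f s = 0) : deriv (deriv f) a = 0 := by
  have h1 : ∀ᶠ s in 𝓝[>] a, deriv f s = 0 := by
    have h2 := eventually_eventually_nhdsWithin.2 h
    filter_upwards [h2, self_mem_nhdsWithin] with s hs hsa
    rw [(isOpen_Ioi.nhdsWithin_eq hsa)] at hs
    have : f =ᶠ[𝓝 s] fun _ => (0 : ℝ) := hs
    rw [this.deriv_eq, deriv_const]
  have hd := hasDerivAt_deriv_of_contDiffAt_two hf
  have h0 : deriv f a = 0 := by
    have t1 : Filter.Tendsto (deriv f) (𝓝[>] a) (𝓝 (deriv f a)) :=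
      hd.continuousAt.tendsto.mono_left nhdsWithin_le_nhds
    exact tendsto_nhds_unique t1 (tendsto_const_nhds.congr' (h1.mono fun s hs => hs.symm))
  have h3 : HasDerivWithinAt (deriv f) 0 (Set.Ioi a) a :=
    (hasDerivWithinAt_const a (Set.Ioi a) (0 : ℝ)).congr_of_eventuallyEq h1 h0
  exact (uniqueDiffWithinAt_Ioi a).eq_deriv _ hd.hasDerivWithinAt h3

/-- A compact relation whose fibre over `a` lies in the open set `U` has all nearby fibres in
`U`. -/
theorem eventually_fiber_subset {X Y : Type*} [TopologicalSpace X] [TopologicalSpace Y]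
    [T2Space X] {R : Set (X × Y)} (hR : IsCompact R) {a : X} {U : Set Y} (hU : IsOpen U)
    (h : ∀ b, (a, b) ∈ R → b ∈ U) : ∀ᶠ a' in 𝓝 a, ∀ b, (a', b) ∈ R → b ∈ U := by
  -- The base points whose fibre leaves `U` form the projection of a compact set, hence a closed
  -- set, and `a` is not in it.
  have hc : IsCompact (R ∩ Prod.snd ⁻¹' Uᶜ) :=
    hR.inter_right (hU.isClosed_compl.preimage continuous_snd)
  have hcl := (hc.image continuous_fst).isClosed
  have ha : a ∈ (Prod.fst '' (R ∩ Prod.snd ⁻¹' Uᶜ))ᶜ := by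
    rintro ⟨⟨a', b⟩, ⟨hb, hbU⟩, rfl⟩
    exact hbU (h b hb)
  filter_upwards [hcl.isOpen_compl.mem_nhds ha] with a' ha' b hb
  by_contra hbU
  exact ha' ⟨(a', b), ⟨hb, hbU⟩, rfl⟩

/-! ### Outward normals -/

/-- Orthogonality to the tangent plane is automatic: along a curve in `S` through `P` the height in
direction `n` is maximal at `P`. -/
theorem isOutwardNormal_iff {S : Set E3} {P n : E3} :
    IsOutwardNormal S P n ↔ P ∈ S ∧ ‖n‖ = 1 ∧ ∀ x ∈ S, inner ℝ (x - P) n ≤ 0 := by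
  refine ⟨fun h => ⟨h.1, h.2.1, h.2.2.2⟩, fun ⟨hP, hn, h⟩ => ⟨hP, hn, ?_, h⟩⟩
  rintro v ⟨γ, ⟨hγ, h0, hS⟩, rfl⟩
  have hmax : IsLocalMax (fun s => inner ℝ (γ s - P) n) 0 := by
    filter_upwards [hS] with s hs
    simpa [h0] using h _ hs
  refine (deriv_inner_right_eventuallyEq hγ P n).self_of_nhds.symm.trans ?_
  exact hmax.deriv_eq_zero

theorem isCompact_setOf_isOutwardNormal {S : Set E3} (hS : IsCompact S) :
    IsCompact {p : E3 × E3 | IsOutwardNormal S p.1 p.2} := by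
  have h : {p : E3 × E3 | IsOutwardNormal S p.1 p.2} =
      (S ×ˢ Metric.sphere 0 1) ∩ ⋂ x ∈ S, {p | inner ℝ (x - p.1) p.2 ≤ 0} := by
    ext p
    simp only [Set.mem_ofPred_eq, isOutwardNormal_iff, Set.mem_inter_iff, Set.mem_prod,
      mem_sphere_zero_iff_norm, Set.mem_iInter, and_assoc]
  rw [h]
  refine (hS.prod (isCompact_sphere 0 1)).inter_right ?_
  exact isClosed_biInter fun x _ => isClosed_le (by fun_prop) continuous_const

theorem exists_isOutwardNormal {S : Set E3} (hS : IsCompact S) (hne : S.Nonempty) {n : E3}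
    (hn : ‖n‖ = 1) : ∃ P, IsOutwardNormal S P n := by
  obtain ⟨P, hP, hmax⟩ := hS.exists_isMaxOn hne
    (f := fun x => inner ℝ x n) (Continuous.continuousOn (by fun_prop))
  refine ⟨P, isOutwardNormal_iff.2 ⟨hP, hn, fun x hx => ?_⟩⟩
  rw [inner_sub_left]
  have : (inner ℝ x n : ℝ) ≤ inner ℝ P n := hmax hx
  linarith

theorem IsOutwardNormal.supportFunction_eq {S : Set E3} {P n : E3} (h : IsOutwardNormal S P n) :
    supportFunction S n = inner ℝ P n := by
  have hg : IsGreatest ((fun x => inner ℝ x n) '' S) (inner ℝ P n : ℝ) := by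
    refine ⟨⟨P, h.1, rfl⟩, ?_⟩
    rintro _ ⟨x, hx, rfl⟩
    have := h.2.2.2 x hx
    rw [inner_sub_left] at this
    show (inner ℝ x n : ℝ) ≤ _
    linarith
  exact hg.csSup_eq

theorem IsOvoid.nonempty {S : Set E3} (hS : IsOvoid S) : S.Nonempty := by
  have := hS.simplyConnected
  obtain ⟨x⟩ : Nonempty S := inferInstance
  exact ⟨x, x.2⟩

/-! ### Curves in a level set -/

/-- The map `Ψ` straightens `S`: since `ℓ u = 1`, it satisfies `ℓ (Ψ x - P) = F x`, and its
derivative at `P` is the identity. Pulling the line `P + s • v` back by its local inverse gives the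
curve. Points are displaced only along `u`, which yields the last clause. -/
theorem exists_isCurveAt {S : Set E3} {P : E3} {F : E3 → ℝ} (hF : ContDiffAt ℝ 2 F P)
    (hFP : F P = 0) (hFS : ∀ᶠ x in 𝓝 P, (x ∈ S ↔ F x = 0)) {u v : E3} (hu : fderiv ℝ F P u = 1)
    (hv : fderiv ℝ F P v = 0) :
    ∃ γ : ℝ → E3, IsCurveAt S P γ ∧ deriv γ 0 = v ∧
      ∀ᶠ s in 𝓝 (0 : ℝ), ∃ τ : ℝ, γ s = P + s • v + τ • u := by
  set ℓ := fderiv ℝ F P with hℓ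
  let Ψ : E3 → E3 := fun x => x + (F x - ℓ (x - P)) • u
  have hΨ : ContDiffAt ℝ 2 Ψ P := by
    refine contDiffAt_id.add (ContDiffAt.smul (hF.sub ?_) contDiffAt_const)
    exact ℓ.contDiff.contDiffAt.comp P (contDiffAt_id.sub contDiffAt_const)
  have hd : HasFDerivAt Ψ (ContinuousLinearMap.id ℝ E3) P := by
    have h1 : HasFDerivAt F ℓ P := (hF.differentiableAt (by simp)).hasFDerivAt
    have h2 : HasFDerivAt (fun x => ℓ (x - P)) ℓ P :=
      ℓ.hasFDerivAt.comp P ((hasFDerivAt_id P).sub_const P)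
    have h3 := (hasFDerivAt_id P).add ((h1.sub h2).smul_const u)
    have h4 : (ℓ - ℓ).smulRight u = 0 := by ext1 w; simp
    rwa [h4, add_zero] at h3
  have hΨP : Ψ P = P := by simp [Ψ, hFP]
  obtain ⟨G, hG, hGP, -, hright⟩ := exists_contDiffAt_localInverse hΨ (by simp)
    (by rw [hd.fderiv]; exact Function.injective_id)
  rw [hΨP] at hG hGP hright
  let c : ℝ → E3 := fun s => P + s • v
  have hc : ContDiffAt ℝ 2 c 0 := by fun_prop
  have hc0 : c 0 = P := by simp [c]
  have hcd : HasDerivAt c v 0 := by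
    have h := ((hasDerivAt_id (0 : ℝ)).smul_const v).const_add P
    rwa [one_smul] at h
  have htend : Filter.Tendsto c (𝓝 0) (𝓝 P) := by
    simpa [hc0] using hc.continuousAt.tendsto
  have hγ : ContDiffAt ℝ 2 (fun s => G (c s)) 0 :=
    ContDiffAt.comp (0 : ℝ) (hc0.symm ▸ hG) hc
  have hγ0 : G (c 0) = P := by rw [hc0, hGP]
  have hγt : Filter.Tendsto (fun s => G (c s)) (𝓝 0) (𝓝 P) := by
    simpa [hγ0] using hγ.continuousAt.tendsto
  have hform : ∀ᶠ s in 𝓝 (0 : ℝ), F (G (c s)) = 0 ∧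
      G (c s) = P + s • v + ℓ (G (c s) - P) • u := by
    filter_upwards [htend.eventually hright] with s hs
    have hs' : G (c s) + (F (G (c s)) - ℓ (G (c s) - P)) • u = P + s • v := hs
    have h1 := congrArg (fun x => ℓ (x - P)) hs'
    have h0 : F (G (c s)) = 0 := by
      simp only [map_sub, map_add, map_smul, hu, hv, smul_eq_mul] at h1
      linarith
    refine ⟨h0, ?_⟩
    rw [← hs', h0]
    module
  refine ⟨fun s => G (c s), ⟨hγ, hγ0, ?_⟩, ?_, hform.mono fun s hs => ⟨_, hs.2⟩⟩
  · filter_upwards [hform, hγt.eventually hFS] with s hs h2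
    exact h2.2 hs.1
  · have h1 : HasFDerivAt Ψ (ContinuousLinearMap.id ℝ E3) (G (c 0)) := by rwa [hγ0]
    have hγd := (hγ.differentiableAt (by simp)).hasDerivAt
    have h2 := h1.comp_hasDerivAt (0 : ℝ) hγd
    have h3 : HasDerivAt (Ψ ∘ fun s => G (c s)) v 0 := by
      refine hcd.congr_of_eventuallyEq ?_
      filter_upwards [htend.eventually hright] with s hs using hs
    simpa using h2.unique h3

/-- The component of `n` orthogonal to the gradient is itself the velocity of a curve in `S`, so it
is orthogonal to `n` and must vanish. -/
theorem IsOutwardNormal.eq_smul_gradient {S : Set E3} {P n : E3} (h : IsOutwardNormal S P n)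
    {F : E3 → ℝ} (hF : ContDiffAt ℝ 2 F P) (hF' : fderiv ℝ F P ≠ 0)
    (hFS : ∀ᶠ x in 𝓝 P, (x ∈ S ↔ F x = 0)) : ∃ α : ℝ, n = α • gradient F P := by
  have hFP : F P = 0 := hFS.self_of_nhds.1 h.1
  set g := gradient F P with hg
  have hgi : ∀ v, inner ℝ g v = fderiv ℝ F P v := fun v => inner_gradient_left
  have hg0 : g ≠ 0 := by
    intro h0
    apply hF'
    ext v
    rw [← hgi v, h0, inner_zero_left]
    rfl
  have hgg : (inner ℝ g g : ℝ) ≠ 0 := inner_self_ne_zero.2 hg0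
  set α : ℝ := inner ℝ g n / inner ℝ g g with hα
  refine ⟨α, ?_⟩
  set r := n - α • g with hr
  have h1 : inner ℝ g r = 0 := by
    rw [hr, inner_sub_right, inner_smul_right, hα, div_mul_cancel₀ _ hgg, sub_self]
  obtain ⟨γ, hγ, hγd, -⟩ := exists_isCurveAt (u := (inner ℝ g g : ℝ)⁻¹ • g) hF hFP hFS
    (by rw [map_smul, ← hgi, smul_eq_mul, inv_mul_cancel₀ hgg]) (v := r) (by rw [← hgi, h1])
  have h2 : inner ℝ r n = 0 := h.2.2.1 r ⟨γ, hγ, hγd⟩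
  have h3 : inner ℝ r r = (0 : ℝ) := by
    nth_rewrite 2 [hr]
    rw [inner_sub_right, h2, inner_smul_right, real_inner_comm, h1]
    simp
  exact sub_eq_zero.1 (inner_self_eq_zero.1 h3)

theorem exists_unit_orthogonal (m : E3) : ∃ n : E3, ‖n‖ = 1 ∧ inner ℝ n m = 0 := by
  have hne : (ℝ ∙ m)ᗮ ≠ ⊥ := by
    intro h
    have h1 := (ℝ ∙ m).finrank_add_finrank_orthogonal
    rw [h, finrank_bot] at h1
    have h2 := finrank_span_le_card (R := ℝ) ({m} : Set E3)
    simp at h1 h2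
    omega
  obtain ⟨v, hv, hv0⟩ := Submodule.exists_mem_ne_zero_of_ne_bot hne
  refine ⟨‖v‖⁻¹ • v, by simp [norm_smul, hv0], ?_⟩
  rw [inner_smul_left, real_inner_comm, Submodule.mem_orthogonal_singleton_iff_inner_right.1 hv,
    mul_zero]

theorem IsOutwardNormal.eq_or_eq_neg {S : Set E3} (hS : IsOvoid S) {P n m : E3}
    (hn : IsOutwardNormal S P n) (hm : IsOutwardNormal S P m) : m = n ∨ m = -n := by
  obtain ⟨F, hF, hF', hFS⟩ := hS.regular P hn.1
  obtain ⟨α, hα⟩ := hn.eq_smul_gradient hF hF' hFS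
  obtain ⟨β, hβ⟩ := hm.eq_smul_gradient hF hF' hFS
  have hα0 : α ≠ 0 := by
    rintro rfl
    have := hn.2.1
    simp [hα] at this
  have h1 : m = (β / α) • n := by rw [hα, smul_smul, div_mul_cancel₀ _ hα0, ← hβ]
  have h2 : |β / α| = 1 := by
    have := hm.2.1
    rwa [h1, norm_smul, hn.2.1, mul_one, Real.norm_eq_abs] at this
  rcases eq_or_eq_neg_of_abs_eq h2 with h | h
  · left; rw [h1, h, one_smul]
  · right; rw [h1, h, neg_one_smul]

theorem IsOutwardNormal.unique {S : Set E3} (hS : IsOvoid S) {P n m : E3}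
    (hn : IsOutwardNormal S P n) (hm : IsOutwardNormal S P m) : m = n := by
  rcases hn.eq_or_eq_neg hS hm with h | h
  · exact h
  exfalso
  subst h
  -- If both `n` and `-n` were outward, `S` would lie in a plane with normal `n`. A point of `S`
  -- extremal in a direction `k` inside that plane would then have both `k` and `n` as normals,
  -- which orthogonality forbids.
  obtain ⟨k, hk, hkn⟩ := exists_unit_orthogonal n
  obtain ⟨X, hX⟩ := exists_isOutwardNormal hS.isCompact hS.nonempty hk
  have hflat : ∀ x ∈ S, inner ℝ (x - P) n = 0 := fun x hx => by
    have h1 := hn.2.2.2 x hx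
    have h2 := hm.2.2.2 x hx
    rw [inner_neg_right] at h2
    linarith
  have hXn : IsOutwardNormal S X n := isOutwardNormal_iff.2 ⟨hX.1, hn.2.1, fun x hx => by
    have h1 := hflat x hx
    have h2 := hflat X hX.1
    rw [inner_sub_left] at h1 h2 ⊢
    linarith⟩
  have hnn : (inner ℝ n n : ℝ) = 1 := by rw [real_inner_self_eq_norm_sq, hn.2.1, one_pow]
  rcases hXn.eq_or_eq_neg hS hX with h | h
  · rw [h, hnn] at hkn; exact one_ne_zero hkn
  · rw [h, inner_neg_left, hnn] at hkn; norm_num at hkn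

/-- Uniqueness at `P` and compactness of the normal relation make the outward normal continuous
there. This settles the sign ambiguity left by a local equation. -/
theorem IsOutwardNormal.eventually_inner_pos {S : Set E3} (hS : IsOvoid S) {P n : E3}
    (hn : IsOutwardNormal S P n) :
    ∀ᶠ x in 𝓝 P, ∀ m, IsOutwardNormal S x m → 0 < (inner ℝ m n : ℝ) := by
  refine eventually_fiber_subset (isCompact_setOf_isOutwardNormal hS.isCompact)
    (U := {m | 0 < (inner ℝ m n : ℝ)}) (isOpen_lt continuous_const (by fun_prop)) ?_
  intro m hm
  have hmn : m = n := hn.unique hS hm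
  subst hmn
  simp [hn.2.1]

/-! ### The local Gauss map -/

/-- `F` is a local equation of `S` at `P` with gradient `n` there, and `N` extends the Gauss map of
`S` to a neighbourhood of `P`. -/
structure IsLocalGaussMap (S : Set E3) (P n : E3) (F : E3 → ℝ) (N : E3 → E3) : Prop where
  contDiffAt_equation : ContDiffAt ℝ 2 F P
  fderiv_equation : ∀ v, fderiv ℝ F P v = inner ℝ n v
  mem_iff : ∀ᶠ x in 𝓝 P, (x ∈ S ↔ F x = 0)
  contDiffAt_map : ContDiffAt ℝ 1 N P
  map_point : N P = n
  eq_map : ∀ᶠ x in 𝓝 P, ∀ m, IsOutwardNormal S x m → m = N x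
  inner_fderiv_normal : ∀ v, inner ℝ (fderiv ℝ N P v) n = 0
  symm_fderiv : ∀ v w, inner ℝ n v = 0 → inner ℝ n w = 0 →
    inner ℝ (fderiv ℝ N P v) w = inner ℝ (fderiv ℝ N P w) v
  curvature_eq : ∀ γ, IsCurveAt S P γ →
    inner ℝ (deriv (deriv γ) 0) (-n) = inner ℝ (fderiv ℝ N P (deriv γ 0)) (deriv γ 0)

theorem IsOutwardNormal.exists_equation {S : Set E3} (hS : IsOvoid S) {P n : E3}
    (hn : IsOutwardNormal S P n) : ∃ F : E3 → ℝ, ContDiffAt ℝ 2 F P ∧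
      gradient F P = n ∧ ∀ᶠ x in 𝓝 P, (x ∈ S ↔ F x = 0) := by
  obtain ⟨F, hF, hF', hFS⟩ := hS.regular P hn.1
  obtain ⟨α, hα⟩ := hn.eq_smul_gradient hF hF' hFS
  have hα0 : α ≠ 0 := by
    rintro rfl
    have := hn.2.1
    simp [hα] at this
  refine ⟨fun x => α * F x, contDiffAt_const.mul hF, ?_, ?_⟩
  · rw [hα]
    refine ext_inner_right ℝ fun v => ?_
    rw [inner_smul_left, inner_gradient_left, inner_gradient_left,
      fderiv_const_mul (hF.differentiableAt (by simp))]
    simp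
  · filter_upwards [hFS] with x hx
    rw [hx]
    simp [hα0]

theorem IsOutwardNormal.exists_isLocalGaussMap {S : Set E3} (hS : IsOvoid S) {P n : E3}
    (hn : IsOutwardNormal S P n) : ∃ F N, IsLocalGaussMap S P n F N := by
  obtain ⟨F, hF, hgP, hFS⟩ := hn.exists_equation hS
  have hnn : (inner ℝ n n : ℝ) = 1 := by rw [real_inner_self_eq_norm_sq, hn.2.1, one_pow]
  have hn0 : n ≠ 0 := by
    rintro rfl
    simp at hnn
  have hgi : ∀ x v, inner ℝ (gradient F x) v = fderiv ℝ F x v :=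
    fun x v => inner_gradient_left
  have hF1 : ContDiffAt ℝ 1 (fderiv ℝ F) P := hF.fderiv_right (by norm_num)
  have hg : ContDiffAt ℝ 1 (gradient F) P :=
    ((InnerProductSpace.toDual ℝ E3).symm.contDiff.contDiffAt).comp P hF1
  have hρ : ContDiffAt ℝ 1 (fun x => ‖gradient F x‖⁻¹) P :=
    (hg.norm ℝ (by rwa [hgP])).inv (by rw [hgP, hn.2.1]; exact one_ne_zero)
  set N : E3 → E3 := fun x => ‖gradient F x‖⁻¹ • gradient F x with hN
  have hN1 : ContDiffAt ℝ 1 N P := hρ.smul hg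
  have hNP : N P = n := by simp [hN, hgP, hn.2.1]
  have hNd : HasFDerivAt N (fderiv ℝ N P) P := (hN1.differentiableAt (by simp)).hasFDerivAt
  have hgne : ∀ᶠ x in 𝓝 P, gradient F x ≠ 0 :=
    hg.continuousAt.eventually_ne (by rwa [hgP])
  refine ⟨F, N, hF, fun v => by rw [← hgi, hgP], hFS, hN1, hNP, ?_, ?_, ?_, ?_⟩
  · have hpos : ∀ᶠ x in 𝓝 P, 0 < (inner ℝ (N x) n : ℝ) := by
      have : ContinuousAt (fun x => (inner ℝ (N x) n : ℝ)) P :=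
        hN1.continuousAt.inner continuousAt_const
      refine this.eventually (lt_mem_nhds ?_)
      show 0 < (inner ℝ (N P) n : ℝ)
      rw [hNP, hnn]
      exact one_pos
    filter_upwards [hn.eventually_inner_pos hS, hpos, hF.eventually (by simp),
      hFS.eventually_nhds, hgne] with x h1 h2 h3 h4 h5 m hm
    have hF' : fderiv ℝ F x ≠ 0 := by
      intro h0
      refine h5 (ext_inner_right ℝ fun v => ?_)
      rw [hgi, h0, inner_zero_left]
      rfl
    obtain ⟨α, hα⟩ := hm.eq_smul_gradient h3 hF' h4
    have hnx : ‖gradient F x‖ ≠ 0 := norm_ne_zero_iff.2 h5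
    have h6 : m = (α * ‖gradient F x‖) • N x := by
      rw [hN, smul_smul, mul_assoc, mul_inv_cancel₀ hnx, mul_one, hα]
    have h7 : |α * ‖gradient F x‖| = 1 := by
      have h8 := hm.2.1
      have h9 : ‖N x‖ = 1 := by simp [hN, norm_smul, hnx]
      rwa [h6, norm_smul, h9, mul_one, Real.norm_eq_abs] at h8
    have h8 := h1 m hm
    rw [h6, inner_smul_left] at h8
    have h9 : 0 < α * ‖gradient F x‖ := pos_of_mul_pos_left h8 h2.le
    rw [h6, ← abs_of_pos h9, h7, one_smul]
  · intro v
    have h1 : (fun x => (inner ℝ (N x) (N x) : ℝ)) =ᶠ[𝓝 P] fun _ => 1 := by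
      filter_upwards [hgne] with x hx
      have : ‖N x‖ = 1 := by simp [hN, norm_smul, hx]
      rw [real_inner_self_eq_norm_sq, this, one_pow]
    have h2 := (hNd.inner ℝ hNd).unique ((hasFDerivAt_const (1 : ℝ) P).congr_of_eventuallyEq h1)
    have h3 := congrArg (fun L => L v) h2
    simp [hNP, fderivInnerCLM_apply] at h3
    have h4 := real_inner_comm n (fderiv ℝ N P v)
    linarith
  -- On tangent vectors the differential of `N` is the Hessian of `F`: the term from differentiating
  -- `‖gradient F x‖⁻¹` carries the factor `fderiv ℝ F P w = 0`.
  · have key : ∀ v w, inner ℝ n w = 0 →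
        inner ℝ (fderiv ℝ N P v) w = fderiv ℝ (fderiv ℝ F) P v w := by
      intro v w hw
      have h1 : HasFDerivAt (fun x => (inner ℝ (N x) w : ℝ)) _ P :=
        hNd.inner ℝ (hasFDerivAt_const w P)
      have h2 : HasFDerivAt (fun x => ‖gradient F x‖⁻¹ * fderiv ℝ F x w) _ P :=
        (hρ.differentiableAt (by simp)).hasFDerivAt.mul
          ((hF1.differentiableAt (by simp)).hasFDerivAt.clm_apply (hasFDerivAt_const w P))
      have h3 : (fun x => (inner ℝ (N x) w : ℝ)) = fun x => ‖gradient F x‖⁻¹ * fderiv ℝ F x w := by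
        funext x
        rw [hN, inner_smul_left, hgi]
        rfl
      rw [h3] at h1
      have h4 := congrArg (fun L => L v) (h1.unique h2)
      have h5 : fderiv ℝ F P w = 0 := by rw [← hgi, hgP, hw]
      simpa [fderivInnerCLM_apply, h5, hgP, hn.2.1] using h4
    intro v w hv hw
    rw [key v w hw, key w v hv]
    exact hF.isSymmSndFDerivAt (by simp) v w
  · rintro γ ⟨hγ, hγ0, hγS⟩
    have ht : Filter.Tendsto γ (𝓝 0) (𝓝 P) := by simpa [hγ0] using hγ.continuousAt.tendsto
    have hFγ : (fun s => F (γ s)) =ᶠ[𝓝 0] fun _ => 0 := by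
      filter_upwards [hγS, ht.eventually hFS] with s h1 h2 using h2.1 h1
    -- Differentiating the orthogonality of `N (γ s)` and the velocity at `0` relates the
    -- acceleration to the differential of `N`.
    have h1 : (fun s => (inner ℝ (N (γ s)) (deriv γ s) : ℝ)) =ᶠ[𝓝 0] fun _ => 0 := by
      filter_upwards [hFγ.eventuallyEq_nhds, eventually_hasDerivAt_of_contDiffAt_two hγ,
        ht.eventually (hF.eventually (by simp))] with s h2 h3 h4
      have h5 := ((h4.differentiableAt (by simp)).hasFDerivAt.comp_hasDerivAt s h3).unique
        ((hasDerivAt_const s (0 : ℝ)).congr_of_eventuallyEq h2)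
      rw [hN, inner_smul_left, hgi, h5, mul_zero]
    have hNd' : HasFDerivAt N (fderiv ℝ N P) (γ 0) := by rwa [hγ0]
    have h2 := hNd'.comp_hasDerivAt (0 : ℝ) (eventually_hasDerivAt_of_contDiffAt_two hγ).self_of_nhds
    have h3 := (h2.inner ℝ (hasDerivAt_deriv_of_contDiffAt_two hγ)).unique
      ((hasDerivAt_const (0 : ℝ) (0 : ℝ)).congr_of_eventuallyEq h1)
    simp only [Function.comp_apply, hγ0, hNP] at h3
    rw [inner_neg_right, real_inner_comm]
    linarith

/-! ### Normal curvatures -/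

section LocalGaussMap

variable {S : Set E3} {P n : E3} {F : E3 → ℝ} {N : E3 → E3}

theorem IsLocalGaussMap.exists_isCurveAt (h : IsLocalGaussMap S P n F N)
    (hn : IsOutwardNormal S P n) {v : E3} (hv : inner ℝ n v = 0) :
    ∃ γ : ℝ → E3, IsCurveAt S P γ ∧ deriv γ 0 = v ∧
      ∀ᶠ s in 𝓝 (0 : ℝ), ∃ τ : ℝ, γ s = P + s • v + τ • n :=
  Ovoid.exists_isCurveAt h.contDiffAt_equation (h.mem_iff.self_of_nhds.1 hn.1) h.mem_iff
    (by rw [h.fderiv_equation, real_inner_self_eq_norm_sq, hn.2.1, one_pow])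
    (by rw [h.fderiv_equation, hv])

theorem IsLocalGaussMap.normalCurvatures_eq (h : IsLocalGaussMap S P n F N) (hS : IsOvoid S)
    (hn : IsOutwardNormal S P n) : normalCurvatures S P =
      {κ | ∃ v, inner ℝ n v = 0 ∧ ‖v‖ = 1 ∧ κ = inner ℝ (fderiv ℝ N P v) v} := by
  ext κ
  constructor
  · rintro ⟨m, γ, hm, hγ, h1, rfl⟩
    rw [hn.unique hS hm]
    refine ⟨deriv γ 0, ?_, h1, h.curvature_eq γ hγ⟩
    rw [real_inner_comm]
    exact hn.2.2.1 _ ⟨γ, hγ, rfl⟩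
  · rintro ⟨v, hv, h1, rfl⟩
    obtain ⟨γ, hγ, rfl, -⟩ := h.exists_isCurveAt hn hv
    exact ⟨n, γ, hn, hγ, h1, (h.curvature_eq γ hγ).symm⟩

theorem normalCurvatures_nonneg {κ : ℝ} (h : κ ∈ normalCurvatures S P) : 0 ≤ κ := by
  obtain ⟨n, γ, hn, ⟨hγ, h0, hγS⟩, -, rfl⟩ := h
  have hmax : IsLocalMax (fun s => inner ℝ (γ s - P) n) 0 := by
    filter_upwards [hγS] with s hs
    simpa [h0] using hn.2.2.2 _ hs
  have hc : ContinuousAt (fun s => (inner ℝ (γ s - P) n : ℝ)) 0 :=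
    (hγ.continuousAt.sub continuousAt_const).inner continuousAt_const
  have := deriv_deriv_nonpos_of_isLocalMax hc hmax
  rw [deriv_deriv_inner_right hγ] at this
  rw [inner_neg_right]
  linarith

/-- A supporting plane touches an ovoid only once at a point of positive curvature. -/
theorem IsOutwardNormal.point_unique (hS : IsOvoid S) (hpos : ∀ κ ∈ normalCurvatures S P, 0 < κ)
    {P' : E3} (hn : IsOutwardNormal S P n) (hn' : IsOutwardNormal S P' n) : P' = P := by
  by_contra hne
  obtain ⟨F, N, h⟩ := hn.exists_isLocalGaussMap hS
  have hnn : (inner ℝ n n : ℝ) = 1 := by rw [real_inner_self_eq_norm_sq, hn.2.1, one_pow]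
  set L := ‖P' - P‖ with hL
  have hL0 : 0 < L := norm_pos_iff.2 (sub_ne_zero.2 hne)
  set v := L⁻¹ • (P' - P) with hvdef
  have hP' : P' = P + L • v := by
    rw [hvdef, smul_inv_smul₀ hL0.ne']
    abel
  have hv1 : ‖v‖ = 1 := by
    rw [hvdef, norm_smul, norm_inv, norm_norm, ← hL, inv_mul_cancel₀ hL0.ne']
  have hv : inner ℝ n v = (0 : ℝ) := by
    have h1 := hn.2.2.2 P' hn'.1
    have h2 := hn'.2.2.2 P hn.1
    have h3 : (inner ℝ (P' - P) n : ℝ) = 0 := by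
      rw [← neg_sub, inner_neg_left] at h2
      linarith
    rw [hvdef, inner_smul_right, real_inner_comm, h3, mul_zero]
  obtain ⟨γ, ⟨hγ, h0, hγS⟩, hγv, hγform⟩ := h.exists_isCurveAt hn hv
  have ht : Filter.Tendsto γ (𝓝 0) (𝓝 P) := by simpa [h0] using hγ.continuousAt.tendsto
  -- The curve over the segment from `P` to `P'` must coincide with it for small `s > 0`. It cannot
  -- rise above the plane, so `τ ≤ 0`; and the tangent plane at `γ s` has `P` and `P'`, hence the
  -- segment point `P + s • v`, on its inner side, so `τ ≥ 0`. The vanishing height then contradicts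
  -- positive curvature in direction `v`.
  have hzero : ∀ᶠ s in 𝓝[>] (0 : ℝ), inner ℝ (γ s - P) n = (0 : ℝ) := by
    filter_upwards [nhdsWithin_le_nhds hγform, nhdsWithin_le_nhds hγS,
      nhdsWithin_le_nhds (ht.eventually (hn.eventually_inner_pos hS)), self_mem_nhdsWithin,
      nhdsWithin_le_nhds (gt_mem_nhds hL0)] with s ⟨τ, hτ⟩ hs hposn hs0 hsL
    have hs0 : 0 < s := hs0
    have e1 : (inner ℝ (γ s - P) n : ℝ) = τ := by
      rw [hτ]
      simp only [inner_sub_left, inner_add_left, inner_smul_left, real_inner_comm n v, hv, hnn,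
        conj_trivial]
      ring
    have hle : τ ≤ 0 := e1 ▸ hn.2.2.2 _ hs
    obtain ⟨m, hm⟩ := hS.oneSided _ hs
    have h1 := hm.2.2.2 P hn.1
    have h2 := hm.2.2.2 P' hn'.1
    have h3 := hposn m hm
    have h4 : (1 - s / L) * inner ℝ (P - γ s) m + s / L * inner ℝ (P' - γ s) m =
        (-τ) * inner ℝ m n := by
      rw [← real_inner_smul_left, ← real_inner_smul_left, ← inner_add_left,
        real_inner_comm n m, ← real_inner_smul_left]
      congr 1
      rw [hτ, hP']
      have : s • v = (s / L) • L • v := by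
        rw [smul_smul (s / L) L v, div_mul_cancel₀ _ hL0.ne']
      rw [this]
      module
    have h5 : s / L < 1 := (div_lt_one hL0).2 hsL
    have h6 : 0 < s / L := div_pos hs0 hL0
    have h7 : (-τ) * inner ℝ m n ≤ 0 := by
      rw [← h4]
      have := mul_nonpos_of_nonneg_of_nonpos (sub_nonneg.2 h5.le) h1
      have := mul_nonpos_of_nonneg_of_nonpos h6.le h2
      linarith
    have h8 : -τ ≤ 0 := nonpos_of_mul_nonpos_left h7 h3
    rw [e1]
    linarith
  have hf : ContDiffAt ℝ 2 (fun s => (inner ℝ (γ s - P) n : ℝ)) 0 :=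
    (hγ.sub contDiffAt_const).inner ℝ contDiffAt_const
  have h1 := deriv_deriv_eq_zero_of_eventually_right hf hzero
  rw [deriv_deriv_inner_right hγ] at h1
  have h2 := hpos _ ⟨n, γ, hn, ⟨hγ, h0, hγS⟩, by rw [hγv, hv1], rfl⟩
  rw [inner_neg_right, h1] at h2
  simp at h2

end LocalGaussMap

/-! ### Principal directions -/

theorem exists_orthonormalBasis_apply_two {n : E3} (hn : ‖n‖ = 1) :
    ∃ b : OrthonormalBasis (Fin 3) ℝ E3, b 2 = n := by
  have ho : Orthonormal ℝ (({2} : Set (Fin 3)).domRestrict fun _ => n) := by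
    refine ⟨fun _ => hn, fun i j hij => ?_⟩
    exact absurd (Subsingleton.elim i j) hij
  obtain ⟨b, hb⟩ := ho.exists_orthonormalBasis_extension_of_card_eq (by simp)
  exact ⟨b, hb 2 rfl⟩

theorem exists_orthonormalBasis_of_inner {u v w : E3} (huu : inner ℝ u u = (1 : ℝ))
    (hvv : inner ℝ v v = (1 : ℝ)) (hww : inner ℝ w w = (1 : ℝ)) (huv : inner ℝ u v = (0 : ℝ))
    (hwu : inner ℝ w u = (0 : ℝ)) (hwv : inner ℝ w v = (0 : ℝ)) :
    ∃ b : OrthonormalBasis (Fin 3) ℝ E3, b 0 = u ∧ b 1 = v ∧ b 2 = w := by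
  have hvu := huv
  have huw := hwu
  have hvw := hwv
  rw [real_inner_comm] at hvu huw hvw
  have ho' : Orthonormal ℝ ![u, v, w] := by
    rw [orthonormal_iff_ite]
    intro i j
    fin_cases i <;> fin_cases j
    exacts [huu, huv, huw, hvu, hvv, hvw, hwu, hwv, hww]
  have ho : Orthonormal ℝ ((Set.univ : Set (Fin 3)).domRestrict ![u, v, w]) :=
    ho'.comp _ Subtype.val_injective
  obtain ⟨b, hb⟩ := ho.exists_orthonormalBasis_extension_of_card_eq (by simp)
  exact ⟨b, hb 0 trivial, hb 1 trivial, hb 2 trivial⟩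

/-- Rotating the tangent frame by a quarter turn negates the off-diagonal entry of `T`, so by the
intermediate value theorem it vanishes at some angle. -/
theorem exists_principal_basis {n : E3} (hn : ‖n‖ = 1) {T : E3 →L[ℝ] E3}
    (hT : ∀ v, inner ℝ (T v) n = 0)
    (hsymm : ∀ v w, inner ℝ n v = 0 → inner ℝ n w = 0 → inner ℝ (T v) w = inner ℝ (T w) v) :
    ∃ (b : OrthonormalBasis (Fin 3) ℝ E3) (l₀ l₁ : ℝ),
      b 2 = n ∧ T (b 0) = l₀ • b 0 ∧ T (b 1) = l₁ • b 1 := by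
  obtain ⟨a, ha⟩ := exists_orthonormalBasis_apply_two hn
  have haa : ∀ i j, inner ℝ (a i) (a j) = if i = j then (1 : ℝ) else 0 :=
    orthonormal_iff_ite.1 a.orthonormal
  have h20 : (inner ℝ n (a 0) : ℝ) = 0 := by rw [← ha, haa]; simp
  have h21 : (inner ℝ n (a 1) : ℝ) = 0 := by rw [← ha, haa]; simp
  let e₀ : ℝ → E3 := fun t => Real.cos t • a 0 + Real.sin t • a 1
  let e₁ : ℝ → E3 := fun t => -Real.sin t • a 0 + Real.cos t • a 1
  have hcont : Continuous fun t => (inner ℝ (T (e₀ t)) (e₁ t) : ℝ) := by fun_prop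
  have hs := hsymm _ _ h20 h21
  have h0 : (inner ℝ (T (e₀ 0)) (e₁ 0) : ℝ) = inner ℝ (T (a 0)) (a 1) := by simp [e₀, e₁]
  have h1 : (inner ℝ (T (e₀ (Real.pi / 2))) (e₁ (Real.pi / 2)) : ℝ) =
      -inner ℝ (T (a 0)) (a 1) := by simp [e₀, e₁, hs]
  obtain ⟨t, ht⟩ : ∃ t, (inner ℝ (T (e₀ t)) (e₁ t) : ℝ) = 0 := by
    have hmem : (0 : ℝ) ∈ Set.uIcc (inner ℝ (T (e₀ 0)) (e₁ 0) : ℝ)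
        (inner ℝ (T (e₀ (Real.pi / 2))) (e₁ (Real.pi / 2)) : ℝ) := by
      rw [h0, h1, Set.mem_uIcc]
      rcases le_total 0 (inner ℝ (T (a 0)) (a 1) : ℝ) with h | h
      · right; exact ⟨by linarith, h⟩
      · left; exact ⟨h, by linarith⟩
    obtain ⟨t, -, ht⟩ := intermediate_value_uIcc hcont.continuousOn hmem
    exact ⟨t, ht⟩
  have hcs := Real.sin_sq_add_cos_sq t
  have hn0 : inner ℝ n (e₀ t) = (0 : ℝ) := by simp [e₀, inner_add_right, inner_smul_right, h20, h21]
  have hn1 : inner ℝ n (e₁ t) = (0 : ℝ) := by simp [e₁, inner_add_right, inner_smul_right, h20, h21]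
  have e00 : inner ℝ (e₀ t) (e₀ t) = (1 : ℝ) := by
    simp only [e₀, inner_add_right, inner_add_left, inner_smul_right, inner_smul_left, haa]
    simp
    linarith
  have e11 : inner ℝ (e₁ t) (e₁ t) = (1 : ℝ) := by
    simp only [e₁, inner_add_right, inner_add_left, inner_smul_right, inner_smul_left, haa]
    simp
    linarith
  have e01 : inner ℝ (e₀ t) (e₁ t) = (0 : ℝ) := by
    simp only [e₀, e₁, inner_add_right, inner_add_left, inner_smul_right, inner_smul_left, haa]
    simp
    ring
  have hnn : (inner ℝ n n : ℝ) = 1 := by rw [real_inner_self_eq_norm_sq, hn, one_pow]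
  obtain ⟨b, b0, b1, b2⟩ := exists_orthonormalBasis_of_inner e00 e11 hnn e01 hn0 hn1
  have hT2 : ∀ v, (inner ℝ (b 2) (T v) : ℝ) = 0 := fun v => by rw [b2, real_inner_comm, hT]
  have hT10 : (inner ℝ (b 1) (T (b 0)) : ℝ) = 0 := by rw [b0, b1, real_inner_comm, ht]
  have hT01 : (inner ℝ (b 0) (T (b 1)) : ℝ) = 0 := by
    rw [b0, b1, real_inner_comm, ← hsymm _ _ hn0 hn1, ht]
  refine ⟨b, inner ℝ (b 0) (T (b 0)), inner ℝ (b 1) (T (b 1)), b2, ?_, ?_⟩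
  · refine (b.sum_repr' (T (b 0))).symm.trans ?_
    rw [Fin.sum_univ_three, hT2, hT10, zero_smul, zero_smul, add_zero, add_zero]
  · refine (b.sum_repr' (T (b 1))).symm.trans ?_
    rw [Fin.sum_univ_three, hT2, hT01, zero_smul, zero_smul, add_zero, zero_add]

theorem isGreatest_isLeast_diagonal_form (l₀ l₁ : ℝ) :
    IsGreatest {κ : ℝ | ∃ x y : ℝ, x ^ 2 + y ^ 2 = 1 ∧ κ = l₀ * x ^ 2 + l₁ * y ^ 2} (max l₀ l₁) ∧
    IsLeast {κ : ℝ | ∃ x y : ℝ, x ^ 2 + y ^ 2 = 1 ∧ κ = l₀ * x ^ 2 + l₁ * y ^ 2} (min l₀ l₁) := by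
  have m0 : l₀ ∈ {κ : ℝ | ∃ x y : ℝ, x ^ 2 + y ^ 2 = 1 ∧ κ = l₀ * x ^ 2 + l₁ * y ^ 2} :=
    ⟨1, 0, by norm_num, by ring⟩
  have m1 : l₁ ∈ {κ : ℝ | ∃ x y : ℝ, x ^ 2 + y ^ 2 = 1 ∧ κ = l₀ * x ^ 2 + l₁ * y ^ 2} :=
    ⟨0, 1, by norm_num, by ring⟩
  refine ⟨⟨by rcases max_choice l₀ l₁ with h | h <;> rwa [h], ?_⟩,
    ⟨by rcases min_choice l₀ l₁ with h | h <;> rwa [h], ?_⟩⟩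
  · rintro _ ⟨x, y, h, rfl⟩
    have h1 := mul_le_mul_of_nonneg_right (le_max_left l₀ l₁) (sq_nonneg x)
    have h2 := mul_le_mul_of_nonneg_right (le_max_right l₀ l₁) (sq_nonneg y)
    calc _ ≤ max l₀ l₁ * (x ^ 2 + y ^ 2) := by linarith
      _ = _ := by rw [h, mul_one]
  · rintro _ ⟨x, y, h, rfl⟩
    have h1 := mul_le_mul_of_nonneg_right (min_le_left l₀ l₁) (sq_nonneg x)
    have h2 := mul_le_mul_of_nonneg_right (min_le_right l₀ l₁) (sq_nonneg y)
    calc min l₀ l₁ = min l₀ l₁ * (x ^ 2 + y ^ 2) := by rw [h, mul_one]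
      _ ≤ _ := by linarith

theorem ρmean_eq_of_normalCurvatures_eq {S : Set E3} {P : E3} {l₀ l₁ : ℝ} (h₀ : 0 < l₀)
    (h₁ : 0 < l₁) (h : normalCurvatures S P =
      {κ : ℝ | ∃ x y : ℝ, x ^ 2 + y ^ 2 = 1 ∧ κ = l₀ * x ^ 2 + l₁ * y ^ 2}) :
    ρmean S P = ENNReal.ofReal ((l₀⁻¹ + l₁⁻¹) / 2) := by
  have hk := isGreatest_isLeast_diagonal_form l₀ l₁
  rw [← h] at hk
  have k0 : κ₀ S P = max l₀ l₁ := hk.1.csSup_eq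
  have k1 : κ₁ S P = min l₀ l₁ := hk.2.csInf_eq
  have hsum : ρ₀ S P + ρ₁ S P = ENNReal.ofReal (l₀⁻¹ + l₁⁻¹) := by
    rw [ρ₀, ρ₁, k0, k1, ENNReal.ofReal_add (by positivity) (by positivity),
      ENNReal.ofReal_inv_of_pos h₀, ENNReal.ofReal_inv_of_pos h₁]
    rcases le_total l₀ l₁ with hl | hl
    · rw [max_eq_right hl, min_eq_left hl, add_comm]
    · rw [max_eq_left hl, min_eq_right hl]
  rw [ρmean, hsum, ENNReal.ofReal_div_of_pos two_pos]
  simp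

/-! ### The inverse Gauss map -/

theorem norm_inv_norm_smul {y : E3} (hy : y ≠ 0) : ‖‖y‖⁻¹ • y‖ = 1 := by
  simp [norm_smul, hy]

theorem contDiffAt_inv_norm_smul {y : E3} (hy : y ≠ 0) :
    ContDiffAt ℝ 1 (fun z : E3 => ‖z‖⁻¹ • z) y :=
  ((contDiffAt_norm ℝ hy).inv (norm_ne_zero_iff.2 hy)).smul contDiffAt_id

theorem fderiv_inv_norm_smul {n : E3} (hn : ‖n‖ = 1) (v : E3) :
    fderiv ℝ (fun z : E3 => ‖z‖⁻¹ • z) n v = v - (inner ℝ n v : ℝ) • n := by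
  have hn0 : n ≠ 0 := by
    rintro rfl
    simp at hn
  have h1 : HasFDerivAt (fun z : E3 => ‖z‖ ^ 2) (2 • innerSL ℝ n) n :=
    (hasStrictFDerivAt_norm_sq n).hasFDerivAt
  have h2 : HasFDerivAt (fun z : E3 => ‖z‖) (fderiv ℝ (fun z : E3 => ‖z‖) n) n :=
    ((contDiffAt_norm ℝ hn0).differentiableAt (n := 1) (by simp)).hasFDerivAt
  have h3 : fderiv ℝ (fun z : E3 => ‖z‖) n v = inner ℝ n v := by
    have := congrArg (fun L => L v) ((h2.pow 2).unique h1)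
    simp [hn] at this
    linarith
  have h4 : HasFDerivAt (fun z : E3 => ‖z‖⁻¹) _ n :=
    (hasDerivAt_inv (norm_ne_zero_iff.2 hn0)).comp_hasFDerivAt n h2
  have h5 : HasFDerivAt (fun z : E3 => ‖z‖⁻¹ • z) _ n := h4.smul (hasFDerivAt_id n)
  have h6 := congrArg (fun L => L v) h5.fderiv
  rw [h6]
  simp [hn, h3]
  abel

/-- `T` is a symmetric endomorphism that annihilates `n`, as the derivative at the unit vector `n`
of an inverse Gauss map is. -/
def IsTangentialSymm (T : E3 →L[ℝ] E3) (n : E3) : Prop :=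
  T n = 0 ∧ ∀ v w, inner ℝ (T v) w = (inner ℝ v (T w) : ℝ)

theorem isTangentialSymm_of_basis {T : E3 →L[ℝ] E3} {n : E3} (b : OrthonormalBasis (Fin 3) ℝ E3)
    {l₀ l₁ : ℝ} (h0 : T (b 0) = l₀ • b 0) (h1 : T (b 1) = l₁ • b 1) (h2 : T (b 2) = 0)
    (hn : b 2 = n) :
    IsTangentialSymm T n ∧ LinearMap.trace ℝ E3 (T : E3 →ₗ[ℝ] E3) = l₀ + l₁ := by
  refine ⟨⟨hn ▸ h2, fun v w => ?_⟩, ?_⟩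
  · have key : ∀ v, T v = (inner ℝ (b 0) v * l₀) • b 0 + (inner ℝ (b 1) v * l₁) • b 1 := by
      intro v
      conv_lhs => rw [← b.sum_repr' v]
      rw [Fin.sum_univ_three, map_add, map_add, map_smul, map_smul, map_smul, h0, h1, h2,
        smul_smul, smul_smul, smul_zero, add_zero]
    rw [key v, key w]
    simp only [inner_add_left, inner_add_right, real_inner_smul_left, real_inner_smul_right]
    rw [real_inner_comm v (b 0), real_inner_comm v (b 1)]
    ring
  · have hbb : ∀ i, inner ℝ (b i) (b i) = (1 : ℝ) := fun i => by
      rw [real_inner_self_eq_norm_sq, b.norm_eq_one, one_pow]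
    rw [LinearMap.trace_eq_sum_inner _ b, Fin.sum_univ_three]
    simp only [ContinuousLinearMap.coe_coe, h0, h1, h2, real_inner_smul_right, hbb]
    simp

/-- Local form of the inverse Gauss map at a point where all normal curvatures are positive. -/
theorem exists_local_inverseGaussMap {S : Set E3} (hS : IsOvoid S) {P n : E3}
    (hpos : ∀ κ ∈ normalCurvatures S P, 0 < κ) (hn : IsOutwardNormal S P n) :
    ∃ G : E3 → E3, ContDiffAt ℝ 1 G n ∧
      (∀ᶠ x in 𝓝 P, ∀ m, IsOutwardNormal S x m → x = G m) ∧
      ∃ (b : OrthonormalBasis (Fin 3) ℝ E3) (l₀ l₁ : ℝ), 0 < l₀ ∧ 0 < l₁ ∧ b 2 = n ∧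
        fderiv ℝ G n (b 0) = l₀⁻¹ • b 0 ∧ fderiv ℝ G n (b 1) = l₁⁻¹ • b 1 ∧
        ρmean S P = ENNReal.ofReal ((l₀⁻¹ + l₁⁻¹) / 2) := by
  obtain ⟨F, N, h⟩ := hn.exists_isLocalGaussMap hS
  have hFP : F P = 0 := h.mem_iff.self_of_nhds.1 hn.1
  obtain ⟨b, l₀, l₁, hb2, hb0, hb1⟩ :=
    exists_principal_basis hn.2.1 h.inner_fderiv_normal h.symm_fderiv
  have hbb : ∀ i j, inner ℝ (b i) (b j) = if i = j then (1 : ℝ) else 0 :=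
    orthonormal_iff_ite.1 b.orthonormal
  have hn0 : (inner ℝ n (b 0) : ℝ) = 0 := by rw [← hb2, hbb]; simp
  have hn1 : (inner ℝ n (b 1) : ℝ) = 0 := by rw [← hb2, hbb]; simp
  have hnn : (inner ℝ n n : ℝ) = 1 := by rw [real_inner_self_eq_norm_sq, hn.2.1, one_pow]
  have hK := h.normalCurvatures_eq hS hn
  have hl₀ : 0 < l₀ := by
    refine hpos _ (hK ▸ ⟨b 0, hn0, b.norm_eq_one 0, ?_⟩)
    rw [hb0, real_inner_smul_left, hbb]
    simp
  have hl₁ : 0 < l₁ := by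
    refine hpos _ (hK ▸ ⟨b 1, hn1, b.norm_eq_one 1, ?_⟩)
    rw [hb1, real_inner_smul_left, hbb]
    simp
  have hdecomp : ∀ v, inner ℝ n v = (0 : ℝ) →
      v = (inner ℝ (b 0) v : ℝ) • b 0 + (inner ℝ (b 1) v : ℝ) • b 1 := by
    intro v hv
    conv_lhs => rw [← b.sum_repr' v, Fin.sum_univ_three, hb2, hv, zero_smul, add_zero]
  have hquad : ∀ x y : ℝ, inner ℝ (fderiv ℝ N P (x • b 0 + y • b 1)) (x • b 0 + y • b 1) =
      l₀ * x ^ 2 + l₁ * y ^ 2 := by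
    intro x y
    simp only [map_add, map_smul, hb0, hb1, inner_add_left, inner_add_right, real_inner_smul_left,
      real_inner_smul_right, hbb]
    simp
    ring
  have hnorm : ∀ x y : ℝ, ‖x • b 0 + y • b 1‖ ^ 2 = x ^ 2 + y ^ 2 := by
    intro x y
    rw [← real_inner_self_eq_norm_sq]
    simp only [inner_add_left, inner_add_right, real_inner_smul_left,
      real_inner_smul_right, hbb]
    simp
    ring
  have hK' : normalCurvatures S P =
      {κ : ℝ | ∃ x y : ℝ, x ^ 2 + y ^ 2 = 1 ∧ κ = l₀ * x ^ 2 + l₁ * y ^ 2} := by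
    rw [hK]
    ext κ
    constructor
    · rintro ⟨v, hv, hv1, rfl⟩
      rw [hdecomp v hv] at hv1 ⊢
      exact ⟨_, _, by rw [← hnorm, hv1, one_pow], hquad _ _⟩
    · rintro ⟨x, y, hxy, rfl⟩
      refine ⟨x • b 0 + y • b 1, ?_, ?_, (hquad x y).symm⟩
      · rw [inner_add_right, real_inner_smul_right, real_inner_smul_right, hn0, hn1]
        simp
      · have := hnorm x y
        rw [hxy] at this
        exact (pow_eq_one_iff_of_nonneg (norm_nonneg _) two_ne_zero).1 this
  -- `N` takes unit values near `P`, so it is not invertible in space. The added term vanishes on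
  -- `S` and supplies the missing normal direction, making the derivative injective while agreeing
  -- with that of `N` on the tangent plane.
  let Φ : E3 → E3 := fun x => N x + F x • n
  have hΦ : ContDiffAt ℝ 1 Φ P :=
    h.contDiffAt_map.add ((h.contDiffAt_equation.of_le (by norm_num)).smul contDiffAt_const)
  have hΦd : ∀ v, fderiv ℝ Φ P v = fderiv ℝ N P v + (inner ℝ n v : ℝ) • n := by
    intro v
    have h1 := (h.contDiffAt_map.differentiableAt (by simp)).hasFDerivAt.add
      ((h.contDiffAt_equation.differentiableAt (by simp)).hasFDerivAt.smul_const n)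
    have h2 : fderiv ℝ Φ P v = _ := congrArg (fun L => L v) h1.fderiv
    rw [h2]
    simp [h.fderiv_equation]
  have hΦP : Φ P = n := by simp [Φ, h.map_point, hFP]
  have hinj : Function.Injective (fderiv ℝ Φ P) := by
    rw [injective_iff_map_eq_zero]
    intro v hv
    rw [hΦd] at hv
    have h1 : (inner ℝ n v : ℝ) = 0 := by
      have := congrArg (fun z => (inner ℝ z n : ℝ)) hv
      rwa [inner_add_left, h.inner_fderiv_normal, real_inner_smul_left, hnn, zero_add, mul_one,
        inner_zero_left] at this
    rw [h1, zero_smul, add_zero] at hv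
    have h2 := hquad (inner ℝ (b 0) v) (inner ℝ (b 1) v)
    rw [← hdecomp v h1, hv, inner_zero_left] at h2
    have h3 : 0 ≤ l₀ * (inner ℝ (b 0) v : ℝ) ^ 2 := by positivity
    have h4 : 0 ≤ l₁ * (inner ℝ (b 1) v : ℝ) ^ 2 := by positivity
    have h5 : l₀ * (inner ℝ (b 0) v : ℝ) ^ 2 = 0 := by linarith
    have h6 : l₁ * (inner ℝ (b 1) v : ℝ) ^ 2 = 0 := by linarith
    simp only [mul_eq_zero, hl₀.ne', hl₁.ne', false_or, pow_eq_zero_iff two_ne_zero] at h5 h6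
    rw [hdecomp v h1, h5, h6]
    simp
  obtain ⟨G, hG, hGn, hleft, hright⟩ := exists_contDiffAt_localInverse hΦ one_ne_zero hinj
  rw [hΦP] at hG hGn hright
  have hGd : ∀ v, fderiv ℝ Φ P (fderiv ℝ G n v) = v := by
    have h1 : HasFDerivAt Φ (fderiv ℝ Φ P) (G n) := by
      rw [hGn]
      exact (hΦ.differentiableAt one_ne_zero).hasFDerivAt
    have h2 := h1.comp n (hG.differentiableAt one_ne_zero).hasFDerivAt
    have h3 := h2.unique ((hasFDerivAt_id n).congr_of_eventuallyEq hright)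
    intro v
    exact congrArg (fun L => L v) h3
  refine ⟨G, hG, ?_, b, l₀, l₁, hl₀, hl₁, hb2, ?_, ?_, ρmean_eq_of_normalCurvatures_eq hl₀ hl₁ hK'⟩
  · filter_upwards [hleft, h.eq_map, h.mem_iff] with x h1 h2 h3 m hm
    have h4 : Φ x = m := by
      show N x + F x • n = m
      rw [h3.1 hm.1, zero_smul, add_zero, ← h2 m hm]
    rw [← h4, h1]
  · apply hinj
    rw [hGd, map_smul, hΦd, hb0, hn0, zero_smul, add_zero, inv_smul_smul₀ hl₀.ne']
  · apply hinj
    rw [hGd, map_smul, hΦd, hb1, hn1, zero_smul, add_zero, inv_smul_smul₀ hl₁.ne']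

/-- Near each `y`, `X` is the local inverse `G` composed with `z ↦ ‖z‖⁻¹ • z`; the normalization
removes the uncontrolled value of the derivative of `G` on `n`. Nonnegativity of the trace is
recorded so that identities between `ENNReal.ofReal` values descend to real ones. -/
theorem exists_inverseGaussMap {S : Set E3} (hS : IsOvoid S)
    (hpos : ∀ P, ∀ κ ∈ normalCurvatures S P, 0 < κ) :
    ∃ X : E3 → E3, (∀ y, y ≠ 0 → ContDiffAt ℝ 1 X y) ∧
      (∀ y, y ≠ 0 → IsOutwardNormal S (X y) (‖y‖⁻¹ • y)) ∧
      ∀ n, ‖n‖ = 1 → IsTangentialSymm (fderiv ℝ X n) n ∧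
        0 ≤ LinearMap.trace ℝ E3 (fderiv ℝ X n : E3 →ₗ[ℝ] E3) ∧
        ρmean S (X n) = ENNReal.ofReal (LinearMap.trace ℝ E3 (fderiv ℝ X n : E3 →ₗ[ℝ] E3) / 2) := by
  have hex : ∀ y : E3, ∃ P, y ≠ 0 → IsOutwardNormal S P (‖y‖⁻¹ • y) := by
    intro y
    by_cases hy : y = 0
    · exact ⟨0, fun h => absurd hy h⟩
    · obtain ⟨P, hP⟩ := exists_isOutwardNormal hS.isCompact hS.nonempty (norm_inv_norm_smul hy)
      exact ⟨P, fun _ => hP⟩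
  choose X hX using hex
  -- The chosen `X` is continuous because the points with a given normal form a singleton, by
  -- `IsOutwardNormal.point_unique`, and the normal relation is compact.
  have hloc : ∀ y, y ≠ 0 → ∀ U : Set E3, IsOpen U → X y ∈ U → ∀ᶠ z in 𝓝 y, X z ∈ U := by
    intro y hy U hU hyU
    have hR : IsCompact {p : E3 × E3 | IsOutwardNormal S p.2 p.1} := by
      have := (isCompact_setOf_isOutwardNormal hS.isCompact).image continuous_swap
      rwa [Set.image_swap_eq_preimage_swap] at this
    have h1 := eventually_fiber_subset hR (a := ‖y‖⁻¹ • y) hU fun P hP => by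
      have hPy : P = X y := IsOutwardNormal.point_unique hS (hpos _) (hX y hy) hP
      rwa [hPy]
    have h2 := (contDiffAt_inv_norm_smul hy).continuousAt.eventually h1
    filter_upwards [h2, isOpen_ne.mem_nhds hy] with z hz hz0
    exact hz _ (hX z hz0)
  have hform : ∀ y, y ≠ 0 → ∀ G : E3 → E3,
      (∀ᶠ x in 𝓝 (X y), ∀ m, IsOutwardNormal S x m → x = G m) →
      X =ᶠ[𝓝 y] fun z => G (‖z‖⁻¹ • z) := by
    intro y hy G hG
    obtain ⟨U, hUsub, hU, hyU⟩ := eventually_nhds_iff.1 hG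
    filter_upwards [hloc y hy U hU hyU, isOpen_ne.mem_nhds hy] with z hz hz0
    exact hUsub _ hz _ (hX z hz0)
  refine ⟨X, fun y hy => ?_, hX, fun n hn => ?_⟩
  · obtain ⟨G, hG, hGX, -⟩ := exists_local_inverseGaussMap hS (hpos _) (hX y hy)
    exact (ContDiffAt.comp (f := fun z : E3 => ‖z‖⁻¹ • z) y hG
      (contDiffAt_inv_norm_smul hy)).congr_of_eventuallyEq
      (hform y hy G hGX)
  · have hn0 : n ≠ 0 := by
      rintro rfl
      simp at hn
    have hXn : IsOutwardNormal S (X n) n := by simpa [hn] using hX n hn0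
    obtain ⟨G, hG, hGX, b, l₀, l₁, hl₀, hl₁, hb2, hb0, hb1, hρ⟩ :=
      exists_local_inverseGaussMap hS (hpos _) hXn
    have hGn : HasFDerivAt G (fderiv ℝ G n) (‖n‖⁻¹ • n) := by
      rw [hn, inv_one, one_smul]
      exact (hG.differentiableAt one_ne_zero).hasFDerivAt
    have hd : fderiv ℝ X n = fderiv ℝ G n ∘L fderiv ℝ (fun z : E3 => ‖z‖⁻¹ • z) n := by
      rw [(hform n hn0 G hGX).fderiv_eq]
      exact (HasFDerivAt.comp (f := fun z : E3 => ‖z‖⁻¹ • z) n hGn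
        ((contDiffAt_inv_norm_smul hn0).differentiableAt one_ne_zero).hasFDerivAt).fderiv
    have hdv : ∀ v, fderiv ℝ X n v = fderiv ℝ G n (v - (inner ℝ n v : ℝ) • n) := fun v => by
      rw [hd, ContinuousLinearMap.comp_apply, fderiv_inv_norm_smul hn]
    have hbb : ∀ i j, inner ℝ (b i) (b j) = if i = j then (1 : ℝ) else 0 :=
      orthonormal_iff_ite.1 b.orthonormal
    have h0 : fderiv ℝ X n (b 0) = l₀⁻¹ • b 0 := by
      rw [hdv, ← hb2, hbb, ← hb0, hb2]
      simp
    have h1 : fderiv ℝ X n (b 1) = l₁⁻¹ • b 1 := by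
      rw [hdv, ← hb2, hbb, ← hb1, hb2]
      simp
    have h2 : fderiv ℝ X n (b 2) = 0 := by
      rw [hdv, ← hb2, hbb]
      simp
    obtain ⟨hT, htr⟩ := isTangentialSymm_of_basis b h0 h1 h2 hb2
    exact ⟨hT, by rw [htr]; positivity, by rw [htr, hρ]⟩

/-! ### Divergence-free tangential fields -/

theorem hasDerivAt_intervalIntegral_of_continuous {f f' : ℝ → ℝ → ℝ} (a b : ℝ)
    (hf' : Continuous fun p : ℝ × ℝ => f' p.1 p.2)
    (hd : ∀ s t, HasDerivAt (fun s => f s t) (f' s t) s) (hf : ∀ s, Continuous (f s)) (s : ℝ) :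
    HasDerivAt (fun s => ∫ t in a..b, f s t) (∫ t in a..b, f' s t) s := by
  have hK : IsCompact (Metric.closedBall s 1 ×ˢ Set.uIcc a b) :=
    (isCompact_closedBall s 1).prod isCompact_uIcc
  obtain ⟨C, hC⟩ := hK.exists_bound_of_continuousOn hf'.continuousOn
  have hf's : ∀ s, Continuous (f' s) := fun s => hf'.comp (Continuous.prodMk_right s)
  refine (intervalIntegral.hasDerivAt_integral_of_dominated_loc_of_deriv_le
    (bound := fun _ => C) (Metric.closedBall_mem_nhds s one_pos)
    (Filter.Eventually.of_forall fun s => (hf s).aestronglyMeasurable)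
    ((hf s).intervalIntegrable a b) (hf's s).aestronglyMeasurable
    (Filter.Eventually.of_forall fun t ht x hx => ?_) intervalIntegrable_const
    (Filter.Eventually.of_forall fun t _ x _ => hd x t)).2
  exact hC (x, t) ⟨hx, Set.uIoc_subset_uIcc ht⟩

/-- Spherical coordinates with pole `c`: `y s t` is the point of the unit sphere with polar angle
`s` and azimuth `t`, the vectors `u s t` and `f t` are the unit tangent vectors in the directions of
`s` and `t`, and `e t` is the equatorial point of azimuth `t`. -/
structure IsSphericalFrame (c : E3) (e f : ℝ → E3) (y u : ℝ → ℝ → E3) : Prop where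
  continuous_e : Continuous e
  continuous_y : Continuous fun p : ℝ × ℝ => y p.1 p.2
  continuous_u : Continuous fun p : ℝ × ℝ => u p.1 p.2
  inner_yy : ∀ s t, inner ℝ (y s t) (y s t) = (1 : ℝ)
  inner_uu : ∀ s t, inner ℝ (u s t) (u s t) = (1 : ℝ)
  inner_ff : ∀ t, inner ℝ (f t) (f t) = (1 : ℝ)
  inner_yu : ∀ s t, inner ℝ (y s t) (u s t) = (0 : ℝ)
  inner_yf : ∀ s t, inner ℝ (y s t) (f t) = (0 : ℝ)
  inner_uf : ∀ s t, inner ℝ (u s t) (f t) = (0 : ℝ)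
  hasDerivAt_f : ∀ t, HasDerivAt f (-e t) t
  hasDerivAt_y_left : ∀ s t, HasDerivAt (fun s => y s t) (u s t) s
  hasDerivAt_y_right : ∀ s t, HasDerivAt (fun t => y s t) (Real.sin s • f t) t
  pole_eq : ∀ s t, c = Real.cos s • y s t - Real.sin s • u s t
  e_eq : ∀ s t, e t = Real.sin s • y s t + Real.cos s • u s t
  f_two_pi : f (2 * Real.pi) = f 0
  y_two_pi : ∀ s, y s (2 * Real.pi) = y s 0
  y_zero : ∀ t, y 0 t = c
  y_pi : ∀ t, y Real.pi t = -c

theorem exists_circle_frame {c : E3} (hc : ‖c‖ = 1) : ∃ e f : ℝ → E3,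
    (∀ t, inner ℝ c (e t) = (0 : ℝ)) ∧ (∀ t, inner ℝ c (f t) = (0 : ℝ)) ∧
    (∀ t, inner ℝ (e t) (e t) = (1 : ℝ)) ∧ (∀ t, inner ℝ (f t) (f t) = (1 : ℝ)) ∧
    (∀ t, inner ℝ (e t) (f t) = (0 : ℝ)) ∧ (∀ t, HasDerivAt e (f t) t) ∧
    (∀ t, HasDerivAt f (-e t) t) ∧ e (2 * Real.pi) = e 0 ∧ f (2 * Real.pi) = f 0 := by
  obtain ⟨b, hb⟩ := exists_orthonormalBasis_apply_two hc
  have hbb : ∀ i j, inner ℝ (b i) (b j) = if i = j then (1 : ℝ) else 0 :=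
    orthonormal_iff_ite.1 b.orthonormal
  let e : ℝ → E3 := fun t => Real.cos t • b 0 + Real.sin t • b 1
  let f : ℝ → E3 := fun t => -Real.sin t • b 0 + Real.cos t • b 1
  have hce : ∀ t, inner ℝ c (e t) = (0 : ℝ) := fun t => by
    rw [← hb]
    simp [e, inner_add_right, real_inner_smul_right, hbb]
  have hcf : ∀ t, inner ℝ c (f t) = (0 : ℝ) := fun t => by
    rw [← hb]
    simp only [f, inner_add_right, real_inner_smul_right, hbb]
    simp
  have hee : ∀ t, inner ℝ (e t) (e t) = (1 : ℝ) := fun t => by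
    simp only [e, inner_add_right, inner_add_left, real_inner_smul_right, real_inner_smul_left, hbb]
    have := Real.sin_sq_add_cos_sq t
    simp
    linarith
  have hff : ∀ t, inner ℝ (f t) (f t) = (1 : ℝ) := fun t => by
    simp only [f, inner_add_right, inner_add_left, real_inner_smul_right, real_inner_smul_left, hbb]
    have := Real.sin_sq_add_cos_sq t
    simp
    linarith
  have hef : ∀ t, inner ℝ (e t) (f t) = (0 : ℝ) := fun t => by
    simp only [e, f, inner_add_right, inner_add_left, real_inner_smul_right, real_inner_smul_left,
      hbb]
    simp
    ring
  have hed : ∀ t, HasDerivAt e (f t) t := fun t =>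
    ((Real.hasDerivAt_cos t).smul_const (b 0)).add ((Real.hasDerivAt_sin t).smul_const (b 1))
  have hfd : ∀ t, HasDerivAt f (-e t) t := fun t => by
    have h := ((Real.hasDerivAt_sin t).neg.smul_const (b 0)).add
      ((Real.hasDerivAt_cos t).smul_const (b 1))
    have h2 : -e t = -Real.cos t • b 0 + -Real.sin t • b 1 := by simp only [e]; module
    rw [h2]
    exact h
  exact ⟨e, f, hce, hcf, hee, hff, hef, hed, hfd, by simp [e], by simp [f]⟩

theorem exists_isSphericalFrame {c : E3} (hc : ‖c‖ = 1) :
    ∃ e f y u, IsSphericalFrame c e f y u := by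
  obtain ⟨e, f, hce, hcf, hee, hff, hef, hed, hfd, he2, hf2⟩ := exists_circle_frame hc
  have hcc : (inner ℝ c c : ℝ) = 1 := by rw [real_inner_self_eq_norm_sq, hc, one_pow]
  have hec' : ∀ t, inner ℝ (e t) c = (0 : ℝ) := fun t => by rw [real_inner_comm, hce]
  have hec : Continuous e := continuous_iff_continuousAt.2 fun t => (hed t).continuousAt
  let y : ℝ → ℝ → E3 := fun s t => Real.cos s • c + Real.sin s • e t
  let u : ℝ → ℝ → E3 := fun s t => -Real.sin s • c + Real.cos s • e t
  have hyc : Continuous fun p : ℝ × ℝ => y p.1 p.2 := by fun_prop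
  have huc : Continuous fun p : ℝ × ℝ => u p.1 p.2 := by fun_prop
  have hyy : ∀ s t, inner ℝ (y s t) (y s t) = (1 : ℝ) := fun s t => by
    simp only [y, inner_add_right, inner_add_left, real_inner_smul_right, real_inner_smul_left,
      hcc, hce, hec', hee]
    have := Real.sin_sq_add_cos_sq s
    linarith
  have huu : ∀ s t, inner ℝ (u s t) (u s t) = (1 : ℝ) := fun s t => by
    simp only [u, inner_add_right, inner_add_left, real_inner_smul_right, real_inner_smul_left,
      hcc, hce, hec', hee]
    have := Real.sin_sq_add_cos_sq s
    linarith
  have hyu : ∀ s t, inner ℝ (y s t) (u s t) = (0 : ℝ) := fun s t => by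
    simp only [y, u, inner_add_right, inner_add_left, real_inner_smul_right, real_inner_smul_left,
      hcc, hce, hec', hee]
    ring
  have hyf : ∀ s t, inner ℝ (y s t) (f t) = (0 : ℝ) := fun s t => by
    simp only [y, inner_add_left, real_inner_smul_left, hcf, hef]
    ring
  have huf : ∀ s t, inner ℝ (u s t) (f t) = (0 : ℝ) := fun s t => by
    simp only [u, inner_add_left, real_inner_smul_left, hcf, hef]
    ring
  refine ⟨e, f, y, u, hec, hyc, huc, hyy, huu, hff, hyu, hyf, huf, hfd, fun s t => ?_,
    fun s t => ?_, fun s t => ?_, fun s t => ?_, hf2, fun s => by simp only [y, he2],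
    fun t => by simp [y], fun t => by simp [y]⟩
  · exact ((Real.hasDerivAt_cos s).smul_const c).add ((Real.hasDerivAt_sin s).smul_const (e t))
  · exact ((hed t).const_smul (Real.sin s)).const_add _
  · have h1 : Real.cos s • y s t - Real.sin s • u s t =
        (Real.sin s ^ 2 + Real.cos s ^ 2) • c := by simp only [y, u]; module
    rw [h1, Real.sin_sq_add_cos_sq, one_smul]
  · have h1 : Real.sin s • y s t + Real.cos s • u s t =
        (Real.sin s ^ 2 + Real.cos s ^ 2) • e t := by simp only [y, u]; module
    rw [h1, Real.sin_sq_add_cos_sq, one_smul]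

/-- Let `I`, `J`, `A` be the integrals over the parallel at polar angle `s` of `⟪Z, c⟫`, `⟪Z, e⟫`
and `⟪D u, u⟫`. Then `I' = -sin s * A`, `J' = cos s * A`, and zero trace gives `J = -sin s * A`.
Hence `sin s * J` is constant, so `J = 0` and `I' = J = 0`. Comparing `I` at the two poles gives the
claim. -/
theorem inner_eq_inner_neg_of_trace_eq_zero {Z : E3 → E3} (hZ : ∀ y, y ≠ 0 → ContDiffAt ℝ 1 Z y)
    (hT : ∀ n, ‖n‖ = 1 → IsTangentialSymm (fderiv ℝ Z n) n)
    (htr : ∀ n, ‖n‖ = 1 → LinearMap.trace ℝ E3 (fderiv ℝ Z n : E3 →ₗ[ℝ] E3) = 0)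
    {c : E3} (hc : ‖c‖ = 1) : (inner ℝ (Z c) c : ℝ) = inner ℝ (Z (-c)) c := by
  obtain ⟨e, f, y, u, h⟩ := exists_isSphericalFrame hc
  have hy1 : ∀ s t, ‖y s t‖ = 1 := fun s t => by
    have := h.inner_yy s t
    rw [real_inner_self_eq_norm_sq] at this
    exact (pow_eq_one_iff_of_nonneg (norm_nonneg _) two_ne_zero).1 this
  have hy0 : ∀ s t, y s t ≠ 0 := fun s t h0 => by
    have := hy1 s t
    simp [h0] at this
  let D : ℝ → ℝ → E3 →L[ℝ] E3 := fun s t => fderiv ℝ Z (y s t)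
  have hDc : Continuous fun p : ℝ × ℝ => D p.1 p.2 := continuous_iff_continuousAt.2 fun p =>
    ContinuousAt.comp (f := fun p : ℝ × ℝ => y p.1 p.2)
      ((hZ _ (hy0 p.1 p.2)).fderiv_right (m := 0) (by simp)).continuousAt h.continuous_y.continuousAt
  have hZc : Continuous fun p : ℝ × ℝ => Z (y p.1 p.2) := continuous_iff_continuousAt.2 fun p =>
    ContinuousAt.comp (f := fun p : ℝ × ℝ => y p.1 p.2)
      (hZ _ (hy0 p.1 p.2)).continuousAt h.continuous_y.continuousAt
  have hZct : ∀ s, Continuous fun t => Z (y s t) := fun s => hZc.comp (Continuous.prodMk_right s)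
  have hDct : ∀ s, Continuous (D s) := fun s => hDc.comp (Continuous.prodMk_right s)
  have huct : ∀ s, Continuous (u s) := fun s => h.continuous_u.comp (Continuous.prodMk_right s)
  have hZd : ∀ s t, HasFDerivAt Z (D s t) (y s t) := fun s t =>
    ((hZ _ (hy0 s t)).differentiableAt one_ne_zero).hasFDerivAt
  have hds : ∀ s t, HasDerivAt (fun s => Z (y s t)) (D s t (u s t)) s := fun s t =>
    (hZd s t).comp_hasDerivAt s (h.hasDerivAt_y_left s t)
  have hdt : ∀ s t, HasDerivAt (fun t => Z (y s t)) (D s t (Real.sin s • f t)) t := fun s t =>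
    (hZd s t).comp_hasDerivAt t (h.hasDerivAt_y_right s t)
  -- By symmetry and `D y = 0` the range of `D` is tangential, so only the `u`-components of `c` and
  -- `e` contribute when they are paired with `D u`.
  have hDy : ∀ s t v, inner ℝ (D s t v) (y s t) = (0 : ℝ) := fun s t v => by
    obtain ⟨h1, h2⟩ := hT _ (hy1 s t)
    show (inner ℝ (fderiv ℝ Z (y s t) v) (y s t) : ℝ) = 0
    rw [h2, h1, inner_zero_right]
  have hDuc : ∀ s t, inner ℝ (D s t (u s t)) c =
      -Real.sin s * inner ℝ (D s t (u s t)) (u s t) := fun s t => by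
    conv_lhs => rw [h.pole_eq s t]
    rw [inner_sub_right, real_inner_smul_right, real_inner_smul_right, hDy]
    ring
  have hDue : ∀ s t, inner ℝ (D s t (u s t)) (e t) =
      Real.cos s * inner ℝ (D s t (u s t)) (u s t) := fun s t => by
    conv_lhs => rw [h.e_eq s t]
    rw [inner_add_right, real_inner_smul_right, real_inner_smul_right, hDy]
    ring
  have hDtr : ∀ s t, inner ℝ (D s t (f t)) (f t) = -(inner ℝ (D s t (u s t)) (u s t) : ℝ) :=
    fun s t => by
      obtain ⟨a, a0, a1, a2⟩ := exists_orthonormalBasis_of_inner (h.inner_uu s t) (h.inner_ff t)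
        (h.inner_yy s t) (h.inner_uf s t) (h.inner_yu s t) (h.inner_yf s t)
      have htr' := htr _ (hy1 s t)
      rw [LinearMap.trace_eq_sum_inner _ a, Fin.sum_univ_three, a0, a1, a2] at htr'
      simp only [ContinuousLinearMap.coe_coe, (hT _ (hy1 s t)).1, inner_zero_right] at htr'
      show inner ℝ (fderiv ℝ Z (y s t) (f t)) (f t) =
        -(inner ℝ (fderiv ℝ Z (y s t) (u s t)) (u s t) : ℝ)
      rw [real_inner_comm, real_inner_comm (u s t)]
      linarith
  let A : ℝ → ℝ := fun s => ∫ t in (0 : ℝ)..2 * Real.pi, inner ℝ (D s t (u s t)) (u s t)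
  let I : ℝ → ℝ := fun s => ∫ t in (0 : ℝ)..2 * Real.pi, inner ℝ (Z (y s t)) c
  let J : ℝ → ℝ := fun s => ∫ t in (0 : ℝ)..2 * Real.pi, inner ℝ (Z (y s t)) (e t)
  have hI : ∀ s, HasDerivAt I (-Real.sin s * A s) s := fun s => by
    have hint := hasDerivAt_intervalIntegral_of_continuous 0 (2 * Real.pi)
      (f := fun s t => inner ℝ (Z (y s t)) c) (f' := fun s t => inner ℝ (D s t (u s t)) c)
      ((hDc.clm_apply h.continuous_u).inner continuous_const)
      (fun s t => by simpa using (hds s t).inner ℝ (hasDerivAt_const s c))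
      (fun s => (hZct s).inner continuous_const) s
    simp only [hDuc, intervalIntegral.integral_const_mul] at hint
    exact hint
  have hJ : ∀ s, HasDerivAt J (Real.cos s * A s) s := fun s => by
    have hint := hasDerivAt_intervalIntegral_of_continuous 0 (2 * Real.pi)
      (f := fun s t => inner ℝ (Z (y s t)) (e t))
      (f' := fun s t => inner ℝ (D s t (u s t)) (e t))
      ((hDc.clm_apply h.continuous_u).inner (h.continuous_e.comp continuous_snd))
      (fun s t => by simpa using (hds s t).inner ℝ (hasDerivAt_const s (e t)))
      (fun s => (hZct s).inner h.continuous_e) s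
    simp only [hDue, intervalIntegral.integral_const_mul] at hint
    exact hint
  -- The `t`-derivative of `⟪Z, f⟫` integrates to zero over the closed parallel; `hDtr` trades `⟪D
  -- f, f⟫` for `-⟪D u, u⟫`.
  have hJA : ∀ s, J s = -Real.sin s * A s := fun s => by
    have hd : ∀ t ∈ Set.uIcc 0 (2 * Real.pi), HasDerivAt (fun t => (inner ℝ (Z (y s t)) (f t) : ℝ))
        (-Real.sin s * inner ℝ (D s t (u s t)) (u s t) - inner ℝ (Z (y s t)) (e t)) t := by
      intro t _
      refine ((hdt s t).inner ℝ (h.hasDerivAt_f t)).congr_deriv ?_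
      rw [map_smul, real_inner_smul_left, hDtr, inner_neg_right]
      ring
    have hAc : Continuous fun t => (inner ℝ (D s t (u s t)) (u s t) : ℝ) :=
      ((hDct s).clm_apply (huct s)).inner (huct s)
    have hJc : Continuous fun t => (inner ℝ (Z (y s t)) (e t) : ℝ) := (hZct s).inner h.continuous_e
    have hAs : Continuous fun t => -Real.sin s * (inner ℝ (D s t (u s t)) (u s t) : ℝ) :=
      continuous_const.mul hAc
    have hint := intervalIntegral.integral_eq_sub_of_hasDerivAt hd
      ((hAs.sub hJc).intervalIntegrable _ _)
    rw [intervalIntegral.integral_sub (hAs.intervalIntegrable _ _)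
      (hJc.intervalIntegrable _ _), intervalIntegral.integral_const_mul, h.f_two_pi, h.y_two_pi,
      sub_self] at hint
    have h2 : -Real.sin s * A s - J s = 0 := hint
    linarith
  have hsJ : ∀ s, Real.sin s * J s = 0 := fun s => by
    have hd : ∀ s, HasDerivAt (fun s => Real.sin s * J s) 0 s := fun s => by
      refine ((Real.hasDerivAt_sin s).mul (hJ s)).congr_deriv ?_
      rw [hJA]
      ring
    have hconst := is_const_of_deriv_eq_zero (fun s => (hd s).differentiableAt)
      (fun s => (hd s).deriv) s 0
    simpa using hconst
  -- Where `sin s = 0` the vanishing comes from `hJA` instead.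
  have hJ0 : ∀ s, J s = 0 := fun s => by
    rcases mul_eq_zero.1 (hsJ s) with h0 | h0
    · rw [hJA, h0]
      ring
    · exact h0
  have hconst := is_const_of_deriv_eq_zero (fun s => (hI s).differentiableAt)
    (fun s => by rw [(hI s).deriv, ← hJA, hJ0]) 0 Real.pi
  have hpi : (2 * Real.pi) ≠ 0 := by positivity
  simpa [I, h.y_zero, h.y_pi, hpi] using hconst

/-! ### Constant width -/

theorem IsOutwardNormal.width_eq {S : Set E3} {P Q n : E3} (hP : IsOutwardNormal S P n)
    (hQ : IsOutwardNormal S Q (-n)) : width S n = inner ℝ (P - Q) n := by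
  rw [width, hP.supportFunction_eq, hQ.supportFunction_eq, inner_neg_right, inner_sub_left]
  ring

/-- The chord lies between the two supporting planes orthogonal to it, which are `w` apart. -/
theorem HasConstantWidth.norm_sub_le {S : Set E3} (hS : IsOvoid S) {w : ℝ} (hw : 0 < w)
    (h : HasConstantWidth S w) {x y : E3} (hx : x ∈ S) (hy : y ∈ S) : ‖x - y‖ ≤ w := by
  rcases eq_or_ne x y with rfl | hxy
  · simpa using hw.le
  have h0 : x - y ≠ 0 := sub_ne_zero.2 hxy
  set u := ‖x - y‖⁻¹ • (x - y) with hu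
  have hu1 : ‖u‖ = 1 := norm_inv_norm_smul h0
  obtain ⟨P, hP⟩ := exists_isOutwardNormal hS.isCompact hS.nonempty hu1
  obtain ⟨Q, hQ⟩ := exists_isOutwardNormal hS.isCompact hS.nonempty (n := -u) (by rwa [norm_neg])
  have h1 := hP.2.2.2 x hx
  have h2 := hQ.2.2.2 y hy
  have h3 := h u hu1
  rw [hP.width_eq hQ] at h3
  have h4 : (inner ℝ (x - y) u : ℝ) = ‖x - y‖ := by
    rw [hu, real_inner_smul_right, real_inner_self_eq_norm_sq, pow_two,
      inv_mul_cancel_left₀ (norm_ne_zero_iff.2 h0)]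
  rw [← h4]
  simp only [inner_sub_left, inner_neg_right] at h1 h2 h3 ⊢
  linarith

/-- This is equality in Cauchy–Schwarz: the component of `P - Q` along `n` is already `w`, the
largest length allowed. -/
theorem HasConstantWidth.sub_eq_smul {S : Set E3} (hS : IsOvoid S) {w : ℝ} (hw : 0 < w)
    (h : HasConstantWidth S w) {P Q n : E3} (hP : IsOutwardNormal S P n)
    (hQ : IsOutwardNormal S Q (-n)) : P - Q = w • n := by
  have h1 := h n hP.2.1
  rw [hP.width_eq hQ] at h1
  have h2 := pow_le_pow_left₀ (norm_nonneg _) (h.norm_sub_le hS hw hP.1 hQ.1) 2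
  have h3 : ‖P - Q - w • n‖ ^ 2 ≤ 0 := by
    rw [norm_sub_sq_real, real_inner_smul_right, h1, norm_smul, hP.2.1, mul_one, Real.norm_eq_abs,
      sq_abs]
    linarith
  have h4 : ‖P - Q - w • n‖ = 0 := by
    have := le_antisymm h3 (sq_nonneg _)
    exact (pow_eq_zero_iff two_ne_zero).1 this
  exact sub_eq_zero.1 (norm_eq_zero.1 h4)

theorem HasConstantWidth.normalCurvatures_pos {S : Set E3} (hS : IsOvoid S) {w : ℝ} (hw : 0 < w)
    (h : HasConstantWidth S w) {P : E3} {κ : ℝ} (hκ : κ ∈ normalCurvatures S P) : 0 < κ := by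
  obtain ⟨n, γ, hP, ⟨hγ, h0, hγS⟩, hγ1, rfl⟩ := hκ
  obtain ⟨Q, hQ⟩ := exists_isOutwardNormal hS.isCompact hS.nonempty (n := -n)
    (by rw [norm_neg, hP.2.1])
  have hPQ := h.sub_eq_smul hS hw hP hQ
  -- Among points of `S`, `P` is at maximal distance `w` from `Q`; the second derivative test along
  -- `γ` then bounds the curvature below by `1 / w`.
  have hmax : IsLocalMax (fun s => (inner ℝ (γ s - Q) (γ s - Q) : ℝ)) 0 := by
    filter_upwards [hγS] with s hs
    have h1 := pow_le_pow_left₀ (norm_nonneg _) (h.norm_sub_le hS hw hs hQ.1) 2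
    rw [real_inner_self_eq_norm_sq, real_inner_self_eq_norm_sq, h0, hPQ, norm_smul, hP.2.1,
      mul_one, Real.norm_eq_abs, sq_abs]
    exact h1
  have hd : ContinuousAt (fun s => γ s - Q) 0 := hγ.continuousAt.sub continuousAt_const
  have h1 := deriv_deriv_nonpos_of_isLocalMax (hd.inner hd) hmax
  rw [deriv_deriv_normSq_sub hγ, h0, hPQ, real_inner_self_eq_norm_sq, hγ1,
    real_inner_smul_right] at h1
  rw [inner_neg_right]
  have h2 : w * (inner ℝ (deriv (deriv γ) 0) n : ℝ) < 0 := by linarith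
  by_contra! hc
  have := mul_nonneg hw.le (neg_nonpos.1 hc)
  linarith

/-- `ENNReal.ofReal` sends every nonpositive `κ₁` to `0`, so a finite `ρ₁` means `κ₁ > 0`;
nonnegativity of the curvatures makes the real infimum a genuine lower bound. -/
theorem normalCurvatures_pos_of_ρmean_ne_top {S : Set E3} {P : E3} (h : ρmean S P ≠ ⊤) {κ : ℝ}
    (hκ : κ ∈ normalCurvatures S P) : 0 < κ := by
  have h1 : ρ₁ S P ≠ ⊤ := by
    intro h0
    apply h
    rw [ρmean, h0, add_top, ENNReal.top_div_of_ne_top (by simp)]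
  rw [ρ₁, ENNReal.inv_ne_top, ne_eq, ENNReal.ofReal_eq_zero, not_le] at h1
  exact h1.trans_le (csInf_le ⟨0, fun _ => normalCurvatures_nonneg⟩ hκ)

/-! ### The width defect field -/

theorem isTangentialSymm_fderiv_inv_norm_smul {n : E3} (hn : ‖n‖ = 1) :
    IsTangentialSymm (fderiv ℝ (fun z : E3 => ‖z‖⁻¹ • z) n) n ∧
      LinearMap.trace ℝ E3 (fderiv ℝ (fun z : E3 => ‖z‖⁻¹ • z) n : E3 →ₗ[ℝ] E3) = 2 := by
  obtain ⟨b, hb⟩ := exists_orthonormalBasis_apply_two hn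
  have hbb : ∀ i j, inner ℝ (b i) (b j) = if i = j then (1 : ℝ) else 0 :=
    orthonormal_iff_ite.1 b.orthonormal
  have h := isTangentialSymm_of_basis (T := fderiv ℝ (fun z : E3 => ‖z‖⁻¹ • z) n) b
    (l₀ := 1) (l₁ := 1)
    (by rw [fderiv_inv_norm_smul hn, ← hb, hbb]; simp)
    (by rw [fderiv_inv_norm_smul hn, ← hb, hbb]; simp)
    (by rw [fderiv_inv_norm_smul hn, ← hb, hbb]; simp) hb
  exact ⟨h.1, h.2.trans (by norm_num)⟩

/-- The field `X y - X (-y) - w y / ‖y‖` that measures the defect from constant width `w` when `X`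
is the inverse Gauss map. -/
noncomputable def widthDefect (X : E3 → E3) (w : ℝ) (y : E3) : E3 :=
  X y - X (-y) - w • (‖y‖⁻¹ • y)

theorem contDiffAt_widthDefect {X : E3 → E3}
    (hX : ∀ y, y ≠ 0 → ContDiffAt ℝ 1 X y) (w : ℝ) {y : E3} (hy : y ≠ 0) :
    ContDiffAt ℝ 1 (widthDefect X w) y :=
  ((hX y hy).sub (ContDiffAt.comp (f := fun z : E3 => -z) y (hX _ (neg_ne_zero.2 hy))
    contDiffAt_id.neg)).sub ((contDiffAt_inv_norm_smul hy).const_smul w)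

/-- The chain rule through `y ↦ -y` contributes a sign, which turns the difference of the two values
of `X` into a sum of derivatives. -/
theorem fderiv_widthDefect {X : E3 → E3}
    (hX : ∀ y, y ≠ 0 → ContDiffAt ℝ 1 X y) (w : ℝ) {n : E3} (hn : n ≠ 0) :
    fderiv ℝ (widthDefect X w) n =
      fderiv ℝ X n + fderiv ℝ X (-n) - w • fderiv ℝ (fun z : E3 => ‖z‖⁻¹ • z) n := by
  have h1 := ((hX n hn).differentiableAt one_ne_zero).hasFDerivAt
  have h2 : HasFDerivAt (fun y => X (-y)) _ n :=
    HasFDerivAt.comp (f := fun z : E3 => -z) n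
      ((hX _ (neg_ne_zero.2 hn)).differentiableAt one_ne_zero).hasFDerivAt (hasFDerivAt_id n).neg
  have h3 := ((contDiffAt_inv_norm_smul hn).differentiableAt one_ne_zero).hasFDerivAt
  have h4 : HasFDerivAt (widthDefect X w) _ n := (h1.sub h2).sub (h3.const_smul w)
  rw [h4.fderiv]
  ext1 v
  simp

theorem trace_fderiv_widthDefect {X : E3 → E3}
    (hX : ∀ y, y ≠ 0 → ContDiffAt ℝ 1 X y) (w : ℝ) {n : E3} (hn : ‖n‖ = 1) :
    LinearMap.trace ℝ E3 (fderiv ℝ (widthDefect X w) n : E3 →ₗ[ℝ] E3) =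
      LinearMap.trace ℝ E3 (fderiv ℝ X n : E3 →ₗ[ℝ] E3) +
        LinearMap.trace ℝ E3 (fderiv ℝ X (-n) : E3 →ₗ[ℝ] E3) - 2 * w := by
  have hn0 : n ≠ 0 := by
    rintro rfl
    simp at hn
  rw [fderiv_widthDefect hX w hn0]
  simp only [ContinuousLinearMap.toLinearMap_sub, ContinuousLinearMap.toLinearMap_add,
    ContinuousLinearMap.toLinearMap_smul, map_add, map_sub, map_smul,
    (isTangentialSymm_fderiv_inv_norm_smul hn).2, smul_eq_mul]
  ring

theorem isTangentialSymm_fderiv_widthDefect {X : E3 → E3}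
    (hX : ∀ y, y ≠ 0 → ContDiffAt ℝ 1 X y) (w : ℝ)
    (hT : ∀ n, ‖n‖ = 1 → IsTangentialSymm (fderiv ℝ X n) n) {n : E3} (hn : ‖n‖ = 1) :
    IsTangentialSymm (fderiv ℝ (widthDefect X w) n) n := by
  have hn0 : n ≠ 0 := by
    rintro rfl
    simp at hn
  obtain ⟨a1, a2⟩ := hT n hn
  obtain ⟨b1, b2⟩ := hT (-n) (by rwa [norm_neg])
  obtain ⟨c1, c2⟩ := (isTangentialSymm_fderiv_inv_norm_smul hn).1
  rw [map_neg, neg_eq_zero] at b1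
  rw [fderiv_widthDefect hX w hn0]
  refine ⟨by simp [a1, b1, c1], fun x y => ?_⟩
  simp only [sub_apply, add_apply, smul_apply, inner_sub_left, inner_add_left, inner_sub_right,
    inner_add_right, real_inner_smul_left, real_inner_smul_right, a2, b2, c2]

theorem IsOvoid.hasConstantWidth_iff {S : Set E3} (hS : IsOvoid S) {w : ℝ} (hw : 0 < w) :
    HasConstantWidth S w ↔
      ∀ P Q, AreOpposite S P Q → ρmean S P + ρmean S Q = ENNReal.ofReal w := by
  have hne : ∀ n : E3, ‖n‖ = 1 → n ≠ 0 := by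
    rintro n hn rfl
    simp at hn
  constructor
  · rintro h P Q ⟨n, hP, hQ⟩
    have hpos : ∀ P, ∀ κ ∈ normalCurvatures S P, 0 < κ := fun P κ hκ =>
      h.normalCurvatures_pos hS hw hκ
    obtain ⟨X, hX, hXS, hXn⟩ := exists_inverseGaussMap hS hpos
    have hn := hP.2.1
    have hn' := hQ.2.1
    have hXP : P = X n := IsOutwardNormal.point_unique hS (hpos _)
      (by simpa [hn] using hXS n (hne n hn)) hP
    have hXQ : Q = X (-n) := IsOutwardNormal.point_unique hS (hpos _)
      (by simpa [hn] using hXS (-n) (hne _ hn')) hQ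
    obtain ⟨-, ha, ha'⟩ := hXn n hn
    obtain ⟨-, hb, hb'⟩ := hXn (-n) hn'
    have hz : widthDefect X w =ᶠ[𝓝 n] fun _ => 0 := by
      filter_upwards [isOpen_ne.mem_nhds (hne n hn)] with y hy
      have h1 := hXS (-y) (neg_ne_zero.2 hy)
      rw [norm_neg, smul_neg] at h1
      rw [widthDefect, h.sub_eq_smul hS hw (hXS y hy) h1, sub_self]
    have htr := trace_fderiv_widthDefect hX w hn
    rw [hz.fderiv_eq, fderiv_const_apply, ContinuousLinearMap.toLinearMap_zero, map_zero] at htr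
    rw [hXP, hXQ, ha', hb', ← ENNReal.ofReal_add (by linarith) (by linarith)]
    congr 1
    linarith
  · intro h
    have hpos : ∀ P, ∀ κ ∈ normalCurvatures S P, 0 < κ := by
      intro P κ hκ
      obtain ⟨n, γ, hP, -⟩ := id hκ
      obtain ⟨Q, hQ⟩ := exists_isOutwardNormal hS.isCompact hS.nonempty (n := -n)
        (by rw [norm_neg, hP.2.1])
      refine normalCurvatures_pos_of_ρmean_ne_top (fun h0 => ?_) hκ
      have h1 := h P Q ⟨n, hP, hQ⟩
      rw [h0, top_add] at h1
      exact ENNReal.ofReal_ne_top h1.symm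
    obtain ⟨X, hX, hXS, hXn⟩ := exists_inverseGaussMap hS hpos
    have hXS' : ∀ n, ‖n‖ = 1 → IsOutwardNormal S (X n) n := fun n hn => by
      simpa [hn] using hXS n (hne n hn)
    intro n hn
    have hZ := inner_eq_inner_neg_of_trace_eq_zero
      (fun y hy => contDiffAt_widthDefect hX w hy)
      (fun n hn => isTangentialSymm_fderiv_widthDefect hX w (fun n hn => (hXn n hn).1) hn)
      (fun n hn => by
        have hn' : ‖-n‖ = 1 := by rwa [norm_neg]
        obtain ⟨-, ha, ha'⟩ := hXn n hn
        obtain ⟨-, hb, hb'⟩ := hXn (-n) hn'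
        have h1 := h _ _ ⟨n, hXS' n hn, hXS' _ hn'⟩
        rw [ha', hb', ← ENNReal.ofReal_add (by linarith) (by linarith),
          ENNReal.ofReal_eq_ofReal_iff (by linarith) hw.le] at h1
        rw [trace_fderiv_widthDefect hX w hn]
        linarith) hn
    rw [(hXS' n hn).width_eq (hXS' (-n) (by rwa [norm_neg]))]
    have hnn : (inner ℝ n n : ℝ) = 1 := by rw [real_inner_self_eq_norm_sq, hn, one_pow]
    -- `widthDefect X w` is an odd field, so `hZ` equates `⟪Z n, n⟫` with its own negative; its
    -- vanishing is the width identity.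
    simp only [widthDefect, norm_neg, neg_neg, hn, inv_one, one_smul, inner_sub_left,
      real_inner_smul_left, inner_neg_left, hnn] at hZ
    rw [inner_sub_left]
    linarith

end Ovoid

theorem mainTheorem5 (S : Set Ovoid.E3) (hS : Ovoid.IsOvoid S) (w : ℝ) (hw : 0 < w) :
    Ovoid.HasConstantWidth S w ↔
      ∀ P Q : Ovoid.E3, Ovoid.AreOpposite S P Q →
        Ovoid.ρmean S P + Ovoid.ρmean S Q = ENNReal.ofReal w := by
  exact hS.hasConstantWidth_iff hw
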